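/- Let $L,R,\alpha,\beta>0$ and $0<d<\pi/2$, and let $\mathscr{D}_d=\{\zeta\in\mathbb{C}:|\operatorname{Im}\zeta|<d\}$. Let $\mathbf{L}^{\mathrm{DE}}_{L,R,\alpha,\beta}(\mathscr{D}_d)$ denote the family of functions $F$ that are analytic in $\mathscr{D}_d$ and satisfy $$|F(\zeta)|\le\frac{L}{|1+e^{-\pi\sinh\zeta}|^{\alpha}\,|1+e^{\pi\sinh\zeta}|^{\beta}}\quad(\zeta\in\mathscr{D}_d),\qquad |F(x)|\le\frac{R}{(1+e^{-\pi\sinh x})^{\alpha}(1+e^{\pi\sinh x})^{\beta}}\quad(x\in\mathbb{R}).$$ Put $q(x)=\dfrac{x}{\operatorname{arsinh}x}$, $p(x)=\dfrac{x}{\operatorname{arsinh}(x/\operatorname{arsinh}x)}$, and $\operatorname{sinc}x=\dfrac{\sin(\pi x)}{\pi x}$ (with $\operatorname{sinc}0=1$). Assume that $F\in\mathbf{L}^{\mathrm{DE}}_{L,R,\alpha,\beta}(\mathscr{D}_d)$. Let $\mu=\min\{\alpha,\beta\}$, let $n\ge1$ be an integer, let $$h=\frac{\operatorname{arsinh}(q(dn/\mu))}{n},$$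 and let $M$ and $N$ be defined by $$M=n,\quad N=\left\lceil\frac1h\operatorname{arsinh}\left(\frac{\alpha}{\beta}\,q\left(\frac{dn}{\mu}\right)\right)\right\rceil\quad\text{if }\mu=\alpha,$$ $$N=n,\quad M=\left\lceil\frac1h\operatorname{arsinh}\left(\frac{\beta}{\alpha}\,q\left(\frac{dn}{\mu}\right)\right)\right\rceil\quad\text{if }\mu=\beta.$$ Then $\max\{M,N\}=n$ and $$\sup_{x\in\mathbb{R}}\left|F(x)-\sum_{k=-M}^{N}F(kh)\operatorname{sinc}\left(\frac{x-kh}{h}\right)\right|\le C\,e^{-\pi dn/\operatorname{arsinh}(dn/\mu)},$$ where $C$ is the constant, independent of $n$, $$C=\frac{2}{\pi d}\left[\frac{2L\,e^{-\pi\mu(p(d/\mu)-q(d/\mu))}}{\pi\mu\,(1-e^{-2\pi\mu p(d/\mu)})\cos^{\alpha+\beta}\left(\frac{\pi}{2}\sin d\right)\cos d}+\frac{\pi}{2}R\right].$$ -/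

import Mathlib

noncomputable section

namespace DESinc

/-- The strip `{ζ : |Im ζ| < d}` in the complex plane. -/
def strip (d : ℝ) : Set ℂ := {ζ : ℂ | |ζ.im| < d}

/-- The class of functions that are analytic in the strip of half-width `d`, with a
double-exponential decay bound with constant `L` on the strip and one with constant `R` on the
real line. -/
def LDE (L R α β d : ℝ) : Set (ℂ → ℂ) :=
  {F : ℂ → ℂ | AnalyticOnNhd ℂ F (strip d) ∧
    (∀ ζ ∈ strip d,
      ‖F ζ‖ ≤ L / (‖1 + Complex.exp (-(Real.pi * Complex.sinh ζ))‖ ^ α *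
        ‖1 + Complex.exp (Real.pi * Complex.sinh ζ)‖ ^ β)) ∧
    (∀ x : ℝ,
      ‖F (x : ℂ)‖ ≤ R / ((1 + Real.exp (-(Real.pi * Real.sinh x))) ^ α *
        (1 + Real.exp (Real.pi * Real.sinh x)) ^ β))}

/-- The normalized cardinal sine `sin (π x) / (π x)`, with value `1` at `0`. -/
def nsinc (x : ℝ) : ℝ := Real.sinc (Real.pi * x)

/-- The truncated Sinc approximation of `F` with mesh size `h` and truncation numbers `M`, `N`. -/
def sincApprox (F : ℂ → ℂ) (h : ℝ) (M N : ℤ) (x : ℝ) : ℂ :=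
  ∑ k ∈ Finset.Icc (-M) N, F (((k : ℝ) * h : ℝ) : ℂ) * (nsinc ((x - (k : ℝ) * h) / h) : ℂ)

/-- The auxiliary function `q x = x / arsinh x`. -/
def q (x : ℝ) : ℝ := x / Real.arsinh x

/-- The auxiliary function `p x = x / arsinh (x / arsinh x)`. -/
def p (x : ℝ) : ℝ := x / Real.arsinh (x / Real.arsinh x)

/-- The explicit constant of the error bound, where `μ = min α β`. -/
def errorConst (L R α β d : ℝ) : ℝ :=
  let μ : ℝ := min α β
  2 / (Real.pi * d) *
    (2 * L * Real.exp (-(Real.pi * μ * (p (d / μ) - q (d / μ)))) /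
        (Real.pi * μ * (1 - Real.exp (-(2 * Real.pi * μ * p (d / μ)))) *
          Real.cos (Real.pi / 2 * Real.sin d) ^ (α + β) * Real.cos d) +
      Real.pi / 2 * R)

end DESinc

end

/-! Away from the nodes, the interpolation error is a contour integral: the residues of F(ζ) /
(sin(πζ/h)(ζ - x)) at x and at the nodes kh combine to it (`sin_mul_rectIntegral`, via
`rectIntegral_div`). On a rectangle whose vertical sides lie midway between nodes, those sides
contribute nothing in the limit of infinite width. Letting the height tend to d leaves a
discretization error proportional to 1 / sinh(πd/h). The horizontal integrals are bounded uniformly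
in the width because F decays double exponentially on each line (`norm_le_of_mem_LDE`), which rests
on the lower bound `le_norm_one_add_exp_pi_sinh`. The nodes outside [-M, N] cost a tail that is
dominated by a telescoping sum (`sum_tail_le`).

The choice of h ties the two errors together. Write X = dn/μ and Q = q(X), so that sinh(nh) = Q. The
tails then decay like exp(-πμ q(X)), the asserted rate, while πd/h = πμ p(X).

A constant independent of n needs two facts about p and q. Since p - q is nondecreasing
(`p_sub_q_le`), the ratio of the discretization error to the rate is controlled by the case n = 1,
where X = d/μ. And X ≤ (π/2) arsinh Q cosh(arsinh Q) (`le_arsinh_q_mul_cosh`) bounds the prefactor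
of each of the two tails by R/(2d). -/

namespace DESinc

/-! ### Monotonicity of q and p - q, and the inequality for arsinh(q x) -/

section

open Real

lemma sinh_lt_mul_cosh {u : ℝ} (hu : 0 < u) : sinh u < u * cosh u := by
  obtain ⟨c, hc, h⟩ := exists_hasDerivAt_eq_slope sinh cosh hu continuous_sinh.continuousOn
    (fun x _ => hasDerivAt_sinh x)
  have h1 : cosh c < cosh u := by
    rw [cosh_lt_cosh, abs_of_pos hc.1, abs_of_pos hu]; exact hc.2
  rw [sinh_zero, sub_zero, sub_zero, eq_div_iff hu.ne'] at h
  nlinarith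

lemma hasDerivAt_sinh_div {u : ℝ} (hu : 0 < u) :
    HasDerivAt (fun u => sinh u / u) ((u * cosh u - sinh u) / u ^ 2) u := by
  have h := (hasDerivAt_sinh u).div (hasDerivAt_id' u) hu.ne'
  rwa [mul_one, mul_comm (cosh u)] at h

lemma sinh_div_strictMonoOn : StrictMonoOn (fun u : ℝ => sinh u / u) (Set.Ioi 0) := by
  refine strictMonoOn_of_deriv_pos (convex_Ioi 0)
    (fun u hu => (hasDerivAt_sinh_div hu).continuousAt.continuousWithinAt) fun u hu => ?_
  rw [interior_Ioi] at hu
  rw [(hasDerivAt_sinh_div hu).deriv]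
  have := sinh_lt_mul_cosh hu
  have hu' : 0 < u := hu
  exact div_pos (by linarith) (by positivity)

lemma q_pos {x : ℝ} (hx : 0 < x) : 0 < q x := div_pos hx (arsinh_pos_iff.2 hx)

lemma q_monotoneOn : MonotoneOn q (Set.Ioi 0) := by
  intro x hx y hy hxy
  have h := sinh_div_strictMonoOn.monotoneOn (arsinh_pos_iff.2 hx) (arsinh_pos_iff.2 hy)
    (arsinh_le_arsinh.2 hxy)
  simpa [sinh_arsinh, q] using h

lemma tanh_pos {x : ℝ} (hx : 0 < x) : 0 < tanh x := by
  rw [tanh_eq_sinh_div_cosh]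
  exact div_pos (sinh_pos_iff.2 hx) (cosh_pos x)

lemma tanh_le_self {x : ℝ} (hx : 0 ≤ x) : tanh x ≤ x := by
  rw [tanh_eq_sinh_div_cosh, div_le_iff₀ (cosh_pos x)]
  rcases hx.eq_or_lt with rfl | h
  · simp
  · exact (sinh_lt_mul_cosh h).le

/-- On [0, 1], cosh u ≤ exp(u²/2) ≤ exp(u/2), and this exponential is cancelled by 1 - u/2 ≤
exp(-u/2). -/
lemma tanh_lower_bound {u : ℝ} (hu : 0 ≤ u) (hu1 : u ≤ 1) : u - u ^ 2 / 2 ≤ tanh u := by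
  rw [tanh_eq_sinh_div_cosh, le_div_iff₀ (cosh_pos u)]
  have h1 : u ≤ sinh u := self_le_sinh_iff.2 hu
  have h2 : (1 - u / 2) * cosh u ≤ 1 := by
    have h3 : 1 - u / 2 ≤ exp (-(u / 2)) := by linarith [add_one_le_exp (-(u / 2))]
    have h4 : cosh u ≤ exp (u / 2) :=
      (cosh_le_exp_half_sq u).trans (exp_le_exp.2 (by nlinarith))
    calc (1 - u / 2) * cosh u ≤ exp (-(u / 2)) * exp (u / 2) := by
          gcongr
      _ = 1 := by rw [← exp_add]; simp
  nlinarith [mul_le_mul_of_nonneg_left h2 hu]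

lemma tanh_mono {x y : ℝ} (h : x ≤ y) : tanh x ≤ tanh y := by
  rw [tanh_eq_sinh_div_cosh, tanh_eq_sinh_div_cosh, div_le_div_iff₀ (cosh_pos x) (cosh_pos y)]
  have := sinh_nonneg_iff.2 (sub_nonneg.2 h)
  rw [sinh_sub] at this
  linarith

/-- The algebraic inequality behind the monotonicity of `p - q`. -/
lemma sub_tanh_mul_le {u w : ℝ} (hu : 0 < u) (hw : sinh w = sinh u / u) :
    (u - tanh u) * (u * tanh w + w ^ 2) ≤ u ^ 2 * w := by
  have hw0 : 0 < w := by rw [← sinh_pos_iff, hw]; exact div_pos (sinh_pos_iff.2 hu) hu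
  have hT : 0 < tanh u := tanh_pos hu
  have ht : 0 < tanh w := tanh_pos hw0
  have hTu := tanh_le_self hu.le
  rcases le_total u 1 with h1 | h1
  · have hw1 : w ≤ 1 := by
      have := sinh_div_strictMonoOn.monotoneOn (a := u) (b := 1) hu (Set.mem_Ioi.2 one_pos) h1
      simp only [div_one] at this
      rwa [← hw, sinh_le_sinh] at this
    have h2 := tanh_lower_bound hu.le h1
    have h3 := tanh_le_self hw0.le
    -- As u and w are both at most 1, u tanh w ≤ w and w² ≤ w.
    calc (u - tanh u) * (u * tanh w + w ^ 2) ≤ (u ^ 2 / 2) * (w + w) := by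
          gcongr
          · linarith
          · nlinarith
          · nlinarith
      _ = u ^ 2 * w := by ring
  · have hw1 : 1 ≤ w := by
      have := sinh_div_strictMonoOn.monotoneOn (a := 1) (b := u) (Set.mem_Ioi.2 one_pos) hu h1
      simp only [div_one] at this
      rwa [← hw, sinh_le_sinh] at this
    have hwu : w ≤ u := by
      rw [← sinh_le_sinh, hw]
      exact div_le_self (sinh_pos_iff.2 hu).le h1
    have h3 : tanh w ≤ tanh u := tanh_mono hwu
    have hT1 : tanh u < 1 := tanh_lt_one u
    have h4 : (u - tanh u) * (u * tanh w + w ^ 2) ≤ (u - tanh u) * (u * tanh u + w ^ 2) := by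
      gcongr
    set T := tanh u
    -- Here T < 1 ≤ w ≤ u. Expanding the product gives (u - T)(uT + w²) ≤ (u² - T²)w, which is at
    -- most u²w.
    have h5 : 0 ≤ (w - T) * (u - w) * (u - T) :=
      mul_nonneg (mul_nonneg (by linarith) (by linarith)) (by linarith)
    nlinarith [mul_pos hT hw0, mul_pos hT hT, mul_nonneg (mul_pos hT hT).le hw0.le]

/-- The substitution x = sinh u turns q x into sinh u / u and p x into sinh u / w, which removes the
outer `arsinh`. -/
lemma hasDerivAt_pq {u w : ℝ} (hu : 0 < u) (hw : w = arsinh (sinh u / u)) :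
    HasDerivAt (fun u => sinh u / arsinh (sinh u / u) - sinh u / u)
      ((cosh u * w - sinh u * ((cosh w)⁻¹ * ((u * cosh u - sinh u) / u ^ 2))) / w ^ 2 -
        (u * cosh u - sinh u) / u ^ 2) u := by
  have hv : 0 < sinh u / u := div_pos (sinh_pos_iff.2 hu) hu
  have hc : √(1 + (sinh u / u) ^ 2) = cosh w := by rw [hw, cosh_arsinh]
  have h1 := HasDerivAt.comp (h := fun u => sinh u / u) u (hasDerivAt_arsinh (sinh u / u))
    (hasDerivAt_sinh_div hu)
  rw [hc] at h1
  have h2 := ((hasDerivAt_sinh u).div h1 (by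
    simpa using (arsinh_pos_iff.2 hv).ne')).sub (hasDerivAt_sinh_div hu)
  rw [hw]
  rw [hw] at h2
  exact h2

lemma sinh_pq_monotoneOn :
    MonotoneOn (fun u => sinh u / arsinh (sinh u / u) - sinh u / u) (Set.Ioi 0) := by
  refine monotoneOn_of_deriv_nonneg (convex_Ioi 0)
    (fun u hu => (hasDerivAt_pq hu rfl).continuousAt.continuousWithinAt)
    (fun u hu => ?_) fun u hu => ?_
  all_goals rw [interior_Ioi] at hu
  · exact (hasDerivAt_pq hu rfl).differentiableAt.differentiableWithinAt
  have hu0 : 0 < u := hu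
  rw [(hasDerivAt_pq hu rfl).deriv]
  set w := arsinh (sinh u / u) with hw
  have hsw : sinh w = sinh u / u := by rw [hw, sinh_arsinh]
  have hw0 : 0 < w := arsinh_pos_iff.2 (div_pos (sinh_pos_iff.2 hu) hu)
  have key := sub_tanh_mul_le hu0 hsw
  have hc := cosh_pos u
  have hcw := cosh_pos w
  have hs : sinh u = tanh u * cosh u := by
    rw [tanh_eq_sinh_div_cosh]; field_simp
  have hcw' : (cosh w)⁻¹ * sinh u = u * tanh w := by
    rw [tanh_eq_sinh_div_cosh, hsw]; field_simp
  have e : (cosh u * w - sinh u * ((cosh w)⁻¹ * ((u * cosh u - sinh u) / u ^ 2))) / w ^ 2 -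
        (u * cosh u - sinh u) / u ^ 2 =
      cosh u * (u ^ 2 * w - (u - tanh u) * (u * tanh w + w ^ 2)) / (u ^ 2 * w ^ 2) := by
    have e1 : sinh u * ((cosh w)⁻¹ * ((u * cosh u - sinh u) / u ^ 2)) =
        u * tanh w * ((u * cosh u - sinh u) / u ^ 2) := by rw [← hcw']; ring
    rw [e1, hs]
    field_simp
    ring
  rw [e]
  exact div_nonneg (mul_nonneg hc.le (by linarith)) (by positivity)

lemma p_sub_q_le {x y : ℝ} (hx : 0 < x) (hxy : x ≤ y) : p x - q x ≤ p y - q y := by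
  have h := sinh_pq_monotoneOn (arsinh_pos_iff.2 hx) (arsinh_pos_iff.2 (hx.trans_le hxy))
    (arsinh_le_arsinh.2 hxy)
  simpa [sinh_arsinh, q, p] using h

lemma p_le_p {x y : ℝ} (hx : 0 < x) (hxy : x ≤ y) : p x ≤ p y := by
  have h1 := p_sub_q_le hx hxy
  have h2 := q_monotoneOn hx (hx.trans_le hxy) hxy
  linarith

lemma p_pos {x : ℝ} (hx : 0 < x) : 0 < p x := div_pos hx (arsinh_pos_iff.2 (q_pos hx))

/-- The tangent bound e·l ≤ exp l almost suffices: from l ≥ 0.57 w alone, l + w can reach about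
2.754 l, slightly above e·l. For w ≤ 2.5, coth w exceeds 1 enough to improve the slope. For w ≥ 2.5,
l lies beyond the tangency point 1, and the quadratic term of the exponential closes the gap. -/
lemma exp_shift_bound {w l s : ℝ} (hw : 0 < w) (hs : 1 ≤ s) (hsw : s = cosh w / sinh w)
    (hl : l = w * (π / 2 * s - 1)) : l + w ≤ exp l + (s - 1) * sinh l := by
  have hpi : 1.57 < π / 2 := by linarith [pi_gt_d2]
  have h157 : 1.57 ≤ π / 2 * s := by nlinarith
  have hl0 : 0.57 * w ≤ l := by rw [hl]; nlinarith
  have hl1 : 0 < l := by linarith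
  have he := exp_one_gt_d9
  have hsinh : 0 ≤ (s - 1) * (sinh l - l) :=
    mul_nonneg (by linarith) (by linarith [self_le_sinh_iff.2 hl1.le])
  rcases le_total w 2.5 with h | h
  · have hs' : 1.01 ≤ s := by
      have h5 : exp (2 * w) ≤ 199 := by
        calc exp (2 * w) ≤ exp 5 := exp_le_exp.2 (by linarith)
          _ = exp 1 ^ 5 := by rw [← exp_nat_mul]; norm_num
          _ ≤ 2.7182818286 ^ 5 := by gcongr; exact exp_one_lt_d9.le
          _ ≤ 199 := by norm_num
      have h6 : exp (2 * w) = exp w * exp w := by rw [← exp_add]; ring_nf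
      have h7 : exp w * exp (-w) = 1 := by rw [← exp_add]; simp
      have h8 : exp w ≤ 199 * exp (-w) := by
        have := exp_pos (-w)
        nlinarith
      rw [hsw, le_div_iff₀ (sinh_pos_iff.2 hw), sinh_eq, cosh_eq]
      linarith [exp_pos (-w)]
    have h1 : exp 1 * l ≤ exp l := by
      have := add_one_le_exp (l - 1)
      have h2 : exp l = exp 1 * exp (l - 1) := by rw [← exp_add]; ring_nf
      rw [h2]
      gcongr
      linarith
    have h3 : 2.718 * l ≤ exp 1 * l := by gcongr; linarith
    -- 1.5857 = 1.57 · 1.01. Now l + w ≤ (1 + 1/0.5857) l < 2.718 l.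
    have h4 : 0.5857 * w ≤ l := by
      have : 1.5857 ≤ π / 2 * s := by nlinarith
      rw [hl]; nlinarith
    nlinarith
  · have h1 : exp 1 * (l + (l - 1) ^ 2 / 2) ≤ exp l := by
      have := quadratic_le_exp_of_nonneg (x := l - 1) (by linarith)
      have h2 : exp l = exp 1 * exp (l - 1) := by rw [← exp_add]; ring_nf
      rw [h2]
      gcongr
      linarith
    have h3 : 2.718 * (l + (l - 1) ^ 2 / 2) ≤ exp 1 * (l + (l - 1) ^ 2 / 2) := by
      gcongr; linarith
    have h4 : 0 ≤ (s - 1) * l := mul_nonneg (by linarith) hl1.le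
    nlinarith [sq_nonneg (l - 1.425)]

/-- The claim says u ≤ U with U = (π/2) w coth w = w + l. Otherwise strict monotonicity of sinh v /
v gives sinh U < U sinh w. Expanding sinh(w + l) as sinh w · (exp l + (s - 1) sinh l), where s =
coth w, contradicts `exp_shift_bound`. -/
lemma mul_sinh_le {u w : ℝ} (hu : 0 < u) (hw : sinh w = sinh u / u) :
    u * sinh w ≤ π / 2 * (w * cosh w) := by
  have hw0 : 0 < w := by rw [← sinh_pos_iff, hw]; exact div_pos (sinh_pos_iff.2 hu) hu
  have hS := sinh_pos_iff.2 hw0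
  have hC := cosh_pos w
  obtain ⟨s, hs⟩ : ∃ s, s = cosh w / sinh w := ⟨_, rfl⟩
  have hs1 : 1 ≤ s := by rw [hs, le_div_iff₀ hS, one_mul]; exact (sinh_lt_cosh w).le
  have hCs : cosh w = s * sinh w := by rw [hs]; field_simp
  obtain ⟨l, hl⟩ : ∃ l, l = w * (π / 2 * s - 1) := ⟨_, rfl⟩
  have h := exp_shift_bound hw0 hs1 hs hl
  rw [← cosh_add_sinh] at h
  by_contra! hcon
  have hU : 0 < w + l := by
    have : w + l = w * (π / 2 * s) := by rw [hl]; ring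
    rw [this]; have := pi_pos; positivity
  have h1 : w + l < u := by
    have e : w + l = π / 2 * (w * cosh w) / sinh w := by
      rw [hCs, hl]; field_simp; ring
    rw [e, div_lt_iff₀ hS]; exact hcon
  have h2 := sinh_div_strictMonoOn hU hu h1
  simp only [← hw] at h2
  rw [div_lt_iff₀ hU, sinh_add, hCs] at h2
  nlinarith

lemma le_arsinh_q_mul_cosh {x : ℝ} (hx : 0 < x) :
    x ≤ π / 2 * (arsinh (q x) * cosh (arsinh (q x))) := by
  have h := mul_sinh_le (u := arsinh x) (w := arsinh (q x)) (arsinh_pos_iff.2 hx) (by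
    rw [sinh_arsinh, sinh_arsinh, q])
  rwa [sinh_arsinh, q, mul_div_cancel₀ _ (arsinh_pos_iff.2 hx).ne'] at h

end

/-! ### Residue theorem for simple poles in a rectangle -/

section

open Complex Set

/-- The integral of `f` over the positively oriented boundary of the rectangle with lower left
corner `z` and upper right corner `w`. -/
noncomputable def rectIntegral (f : ℂ → ℂ) (z w : ℂ) : ℂ :=
  (∫ x : ℝ in z.re..w.re, f (x + z.im * I)) - (∫ x : ℝ in z.re..w.re, f (x + w.im * I)) +
    I • (∫ y : ℝ in z.im..w.im, f (w.re + y * I)) - I • ∫ y : ℝ in z.im..w.im, f (z.re + y * I)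

/-- The boundary of the rectangle with lower left corner `z` and upper right corner `w`. -/
def rectBoundary (z w : ℂ) : Set ℂ :=
  (Icc z.re w.re ×ℂ Icc z.im w.im) \ (Ioo z.re w.re ×ℂ Ioo z.im w.im)

section

variable {z w : ℂ}

lemma bottom_mem (him : z.im < w.im) {x : ℝ} (hx : x ∈ Icc z.re w.re) :
    (x + z.im * I : ℂ) ∈ rectBoundary z w := by
  simp [rectBoundary, mem_reProdIm, him.le]; exact hx

lemma top_mem (him : z.im < w.im) {x : ℝ} (hx : x ∈ Icc z.re w.re) :
    (x + w.im * I : ℂ) ∈ rectBoundary z w := by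
  simp [rectBoundary, mem_reProdIm, him.le]; exact hx

lemma left_mem (hre : z.re < w.re) {y : ℝ} (hy : y ∈ Icc z.im w.im) :
    (z.re + y * I : ℂ) ∈ rectBoundary z w := by
  simp [rectBoundary, mem_reProdIm, hre.le]; exact hy

lemma right_mem (hre : z.re < w.re) {y : ℝ} (hy : y ∈ Icc z.im w.im) :
    (w.re + y * I : ℂ) ∈ rectBoundary z w := by
  simp [rectBoundary, mem_reProdIm, hre.le]; exact hy

lemma intervalIntegrable_side {f : ℂ → ℂ} {s : Set ℂ} (hf : ContinuousOn f s) {a b : ℝ}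
    (hab : a ≤ b) {γ : ℝ → ℂ} (hγ : Continuous γ) (hs : ∀ t ∈ Icc a b, γ t ∈ s) :
    IntervalIntegrable (fun t => f (γ t)) MeasureTheory.volume a b := by
  apply ContinuousOn.intervalIntegrable
  rw [uIcc_of_le hab]
  exact hf.comp hγ.continuousOn hs

lemma rectIntegral_add (hre : z.re < w.re) (him : z.im < w.im) {f g : ℂ → ℂ}
    (hf : ContinuousOn f (rectBoundary z w)) (hg : ContinuousOn g (rectBoundary z w)) :
    rectIntegral (fun ζ => f ζ + g ζ) z w = rectIntegral f z w + rectIntegral g z w := by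
  have hb {f : ℂ → ℂ} (hf : ContinuousOn f (rectBoundary z w)) :=
    intervalIntegrable_side hf hre.le (γ := fun x : ℝ => (x + z.im * I : ℂ)) (by fun_prop)
      (fun t ht => bottom_mem him ht)
  have ht {f : ℂ → ℂ} (hf : ContinuousOn f (rectBoundary z w)) :=
    intervalIntegrable_side hf hre.le (γ := fun x : ℝ => (x + w.im * I : ℂ)) (by fun_prop)
      (fun t ht => top_mem him ht)
  have hr {f : ℂ → ℂ} (hf : ContinuousOn f (rectBoundary z w)) :=
    intervalIntegrable_side hf him.le (γ := fun y : ℝ => (w.re + y * I : ℂ)) (by fun_prop)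
      (fun t ht => right_mem hre ht)
  have hl {f : ℂ → ℂ} (hf : ContinuousOn f (rectBoundary z w)) :=
    intervalIntegrable_side hf him.le (γ := fun y : ℝ => (z.re + y * I : ℂ)) (by fun_prop)
      (fun t ht => left_mem hre ht)
  simp only [rectIntegral]
  rw [intervalIntegral.integral_add (hb hf) (hb hg), intervalIntegral.integral_add (ht hf) (ht hg),
    intervalIntegral.integral_add (hr hf) (hr hg), intervalIntegral.integral_add (hl hf) (hl hg)]
  simp only [smul_eq_mul]
  ring

lemma rectIntegral_congr (hre : z.re < w.re) (him : z.im < w.im) {f g : ℂ → ℂ}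
    (hfg : EqOn f g (rectBoundary z w)) : rectIntegral f z w = rectIntegral g z w := by
  have hc {p q : ℝ} (hpq : p ≤ q) {γ : ℝ → ℂ} (hγ : ∀ t ∈ Icc p q, γ t ∈ rectBoundary z w) :
      ∫ t in p..q, f (γ t) = ∫ t in p..q, g (γ t) :=
    intervalIntegral.integral_congr fun t ht => hfg (hγ t (by rwa [uIcc_of_le hpq] at ht))
  simp only [rectIntegral]
  rw [hc hre.le (fun _ => bottom_mem him), hc hre.le (fun _ => top_mem him),
    hc him.le (fun _ => right_mem hre), hc him.le (fun _ => left_mem hre)]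

lemma rectIntegral_const_mul (c : ℂ) (f : ℂ → ℂ) :
    rectIntegral (fun ζ => c * f ζ) z w = c * rectIntegral f z w := by
  simp only [rectIntegral, intervalIntegral.integral_const_mul, smul_eq_mul]
  ring

lemma rectIntegral_eq_zero (hre : z.re < w.re) (him : z.im < w.im) {f : ℂ → ℂ}
    (hf : DifferentiableOn ℂ f (Icc z.re w.re ×ℂ Icc z.im w.im)) : rectIntegral f z w = 0 :=
  integral_boundary_rect_eq_zero_of_differentiableOn f z w (by
    rwa [uIcc_of_le hre.le, uIcc_of_le him.le])

lemma log_neg_sub_log_of_im_pos {a : ℂ} (ha : 0 < a.im) : log (-a) - log a = -(Real.pi * I) := by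
  simp only [log, norm_neg, arg_neg_eq_arg_sub_pi_of_im_pos ha]
  push_cast; ring

lemma log_neg_sub_log_of_im_neg {a : ℂ} (ha : a.im < 0) : log (-a) - log a = Real.pi * I := by
  simp only [log, norm_neg, arg_neg_eq_arg_add_pi_of_im_neg ha]
  push_cast; ring

lemma integral_inv_horizontal {b : ℂ} {p q y : ℝ} (hy : y ≠ b.im) :
    ∫ x : ℝ in p..q, (x + y * I - b)⁻¹ = log (q + y * I - b) - log (p + y * I - b) := by
  have hs (x : ℝ) : (x + y * I - b : ℂ) ∈ slitPlane := by
    right; simpa [sub_eq_zero] using hy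
  have hd (x : ℝ) : HasDerivAt (fun x : ℝ => log (x + y * I - b)) ((x + y * I - b : ℂ)⁻¹) x := by
    have h1 : HasDerivAt (fun x : ℝ => (x + y * I - b : ℂ)) 1 x :=
      ((ofRealCLM.hasDerivAt (x := x)).add_const _).sub_const _
    simpa using h1.clog_real (hs x)
  refine intervalIntegral.integral_eq_sub_of_hasDerivAt (fun x _ => hd x) ?_
  apply Continuous.intervalIntegrable
  exact Continuous.inv₀ (by fun_prop) fun x => slitPlane_ne_zero (hs x)

lemma integral_inv_right {b : ℂ} {p q x : ℝ} (hx : b.re < x) :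
    I * ∫ y : ℝ in p..q, (x + y * I - b)⁻¹ = log (x + q * I - b) - log (x + p * I - b) := by
  have hs (y : ℝ) : (x + y * I - b : ℂ) ∈ slitPlane := by
    left; simpa using hx
  have hd (y : ℝ) : HasDerivAt (fun y : ℝ => log (x + y * I - b)) (I * (x + y * I - b : ℂ)⁻¹) y := by
    have h1 : HasDerivAt (fun y : ℝ => (x + y * I - b : ℂ)) (1 * I) y :=
      (((ofRealCLM.hasDerivAt (x := y)).mul_const I).const_add _).sub_const _
    have := h1.clog_real (hs y)
    rwa [one_mul, div_eq_mul_inv] at this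
  rw [← intervalIntegral.integral_const_mul]
  refine intervalIntegral.integral_eq_sub_of_hasDerivAt (fun x _ => hd x) ?_
  apply Continuous.intervalIntegrable
  exact continuous_const.mul (Continuous.inv₀ (by fun_prop) fun x => slitPlane_ne_zero (hs x))

lemma integral_inv_left {b : ℂ} {p q x : ℝ} (hx : x < b.re) :
    I * ∫ y : ℝ in p..q, (x + y * I - b)⁻¹ = log (-(x + q * I - b)) - log (-(x + p * I - b)) := by
  have hs (y : ℝ) : (-(x + y * I - b) : ℂ) ∈ slitPlane := by
    left; simpa using hx
  have hd (y : ℝ) :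
      HasDerivAt (fun y : ℝ => log (-(x + y * I - b))) (I * (x + y * I - b : ℂ)⁻¹) y := by
    have h1 : HasDerivAt (fun y : ℝ => (-(x + y * I - b) : ℂ)) (-(1 * I)) y :=
      ((((ofRealCLM.hasDerivAt (x := y)).mul_const I).const_add _).sub_const _).neg
    have := h1.clog_real (hs y)
    rwa [one_mul, neg_div_neg_eq, div_eq_mul_inv] at this
  rw [← intervalIntegral.integral_const_mul]
  refine intervalIntegral.integral_eq_sub_of_hasDerivAt (fun x _ => hd x) ?_
  apply Continuous.intervalIntegrable
  exact continuous_const.mul (Continuous.inv₀ (by fun_prop) fun x => by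
    have := slitPlane_ne_zero (hs x)
    exact fun h => this (by rw [h, neg_zero]))

/-- The cut of log(ζ - b) meets only the left side, where log(-(ζ - b)) serves as primitive instead.
The mismatches at the two left corners are πi each and add up to 2πi. -/
lemma rectIntegral_inv_sub {b : ℂ} (hb : b ∈ Ioo z.re w.re ×ℂ Ioo z.im w.im) :
    rectIntegral (fun ζ => (ζ - b)⁻¹) z w = 2 * Real.pi * I := by
  obtain ⟨⟨h1, h2⟩, h3, h4⟩ := hb
  simp only [rectIntegral, smul_eq_mul]
  rw [integral_inv_horizontal h3.ne, integral_inv_horizontal h4.ne', integral_inv_right h2,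
    integral_inv_left h1]
  have e1 := log_neg_sub_log_of_im_pos (a := z.re + w.im * I - b) (by simpa using h4)
  have e2 := log_neg_sub_log_of_im_neg (a := z.re + z.im * I - b) (by simpa using h3)
  linear_combination e2 - e1

/-- The residue theorem for a quotient with finitely many simple poles in a rectangle. -/
theorem rectIntegral_div (hre : z.re < w.re) (him : z.im < w.im) {U : Set ℂ} (hU : IsOpen U)
    (hRU : Icc z.re w.re ×ℂ Icc z.im w.im ⊆ U) (S : Finset ℂ) {f D : ℂ → ℂ}
    (hf : DifferentiableOn ℂ f U) (hD : DifferentiableOn ℂ D U)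
    (hS : ∀ a ∈ S, a ∈ Ioo z.re w.re ×ℂ Ioo z.im w.im) (hS0 : ∀ a ∈ S, D a = 0)
    (hS1 : ∀ a ∈ S, deriv D a ≠ 0)
    (hne : ∀ ζ ∈ Icc z.re w.re ×ℂ Icc z.im w.im, ζ ∉ S → D ζ ≠ 0) :
    rectIntegral (fun ζ => f ζ / D ζ) z w = 2 * Real.pi * I * ∑ a ∈ S, f a / deriv D a := by
  induction S using Finset.induction_on generalizing f D with
  | empty =>
    rw [Finset.sum_empty, mul_zero]
    exact rectIntegral_eq_zero hre him
      ((hf.mono hRU).div (hD.mono hRU) fun ζ hζ => hne ζ hζ (Finset.notMem_empty ζ))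
  | insert b S hbS ih =>
    have hsub : Ioo z.re w.re ×ℂ Ioo z.im w.im ⊆ Icc z.re w.re ×ℂ Icc z.im w.im := fun ζ hζ =>
      ⟨Ioo_subset_Icc_self hζ.1, Ioo_subset_Icc_self hζ.2⟩
    have hbI := hS b (Finset.mem_insert_self b S)
    have hbU : b ∈ U := hRU (hsub hbI)
    have hb0 := hS0 b (Finset.mem_insert_self b S)
    have hUb := hU.mem_nhds hbU
    obtain ⟨D₁, hD₁⟩ : ∃ D₁, D₁ = dslope D b := ⟨_, rfl⟩
    have hDD (ζ : ℂ) : D ζ = (ζ - b) * D₁ ζ := by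
      have := sub_smul_dslope D b ζ
      rw [hb0, sub_zero, smul_eq_mul] at this
      rw [hD₁, this]
    have hD₁U : DifferentiableOn ℂ D₁ U := by
      rw [hD₁]; exact (differentiableOn_dslope hUb).2 hD
    have hD₁b : D₁ b = deriv D b := by rw [hD₁, dslope_same]
    have hD₁b0 : D₁ b ≠ 0 := by
      rw [hD₁b]; exact hS1 b (Finset.mem_insert_self b S)
    -- c is the residue at b. Subtracting c D₁ makes the numerator vanish at b, so that f/D = f₁/D₁
    -- + c/(ζ - b) with one pole fewer in the first term.
    obtain ⟨c, hc⟩ : ∃ c, c = f b / D₁ b := ⟨_, rfl⟩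
    obtain ⟨f₁, hf₁⟩ : ∃ f₁, f₁ = dslope (fun ζ => f ζ - c * D₁ ζ) b := ⟨_, rfl⟩
    have hf₁U : DifferentiableOn ℂ f₁ U := by
      rw [hf₁]; exact (differentiableOn_dslope hUb).2 (hf.sub (hD₁U.const_mul c))
    have hff (ζ : ℂ) : f ζ = c * D₁ ζ + (ζ - b) * f₁ ζ := by
      have := sub_smul_dslope (fun ζ => f ζ - c * D₁ ζ) b ζ
      rw [hc, div_mul_cancel₀ _ hD₁b0, sub_self, sub_zero, smul_eq_mul, ← hc, ← hf₁] at this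
      rw [this]; ring
    have hane {a : ℂ} (ha : a ∈ S) : a - b ≠ 0 := by
      rw [sub_ne_zero]; rintro rfl; exact hbS ha
    have hS0' : ∀ a ∈ S, D₁ a = 0 := fun a ha => by
      have := hS0 a (Finset.mem_insert_of_mem ha)
      rw [hDD] at this
      exact (mul_eq_zero.1 this).resolve_left (hane ha)
    have hder : ∀ a ∈ S, deriv D a = (a - b) * deriv D₁ a := fun a ha => by
      have haU : U ∈ nhds a := hU.mem_nhds (hRU (hsub (hS a (Finset.mem_insert_of_mem ha))))
      have h1 : HasDerivAt (fun ζ => (ζ - b) * D₁ ζ) _ a :=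
        ((hasDerivAt_id a).sub_const b).mul (hD₁U.differentiableAt haU).hasDerivAt
      rw [funext hDD, h1.deriv, hS0' a ha]
      simp
    have hne' : ∀ ζ ∈ Icc z.re w.re ×ℂ Icc z.im w.im, ζ ∉ S → D₁ ζ ≠ 0 := fun ζ hζ hζS => by
      by_cases hζb : ζ = b
      · rwa [hζb]
      · have := hne ζ hζ (by simp [hζb, hζS])
        rw [hDD] at this
        exact right_ne_zero_of_mul this
    have hbd : ∀ ζ ∈ rectBoundary z w, D₁ ζ ≠ 0 ∧ ζ - b ≠ 0 := fun ζ hζ => by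
      refine ⟨hne' ζ hζ.1 fun h => hζ.2 (hS ζ (Finset.mem_insert_of_mem h)), ?_⟩
      rw [sub_ne_zero]; rintro rfl; exact hζ.2 hbI
    have hBU : rectBoundary z w ⊆ U := fun ζ hζ => hRU hζ.1
    have key : rectIntegral (fun ζ => f ζ / D ζ) z w =
        rectIntegral (fun ζ => f₁ ζ / D₁ ζ) z w + c * rectIntegral (fun ζ => (ζ - b)⁻¹) z w := by
      rw [← rectIntegral_const_mul, ← rectIntegral_add hre him]
      · refine rectIntegral_congr hre him fun ζ hζ => ?_
        obtain ⟨h1, h2⟩ := hbd ζ hζ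
        rw [hff ζ, hDD ζ]
        field_simp
        ring
      · exact ((hf₁U.continuousOn.mono hBU).div (hD₁U.continuousOn.mono hBU)
          fun ζ hζ => (hbd ζ hζ).1)
      · exact continuousOn_const.mul (ContinuousOn.inv₀ (by fun_prop) fun ζ hζ => (hbd ζ hζ).2)
    rw [key, rectIntegral_inv_sub hbI, ih hf₁U hD₁U
      (fun a ha => hS a (Finset.mem_insert_of_mem ha)) hS0' (fun a ha => ?_) hne',
      Finset.sum_insert hbS, ← hD₁b, ← hc]
    · have : ∑ a ∈ S, f a / deriv D a = ∑ a ∈ S, f₁ a / deriv D₁ a := by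
        refine Finset.sum_congr rfl fun a ha => ?_
        rw [hff a, hS0' a ha, hder a ha, mul_zero, zero_add, mul_div_mul_left _ _ (hane ha)]
      rw [this]; ring
    · have := hS1 a (Finset.mem_insert_of_mem ha)
      rw [hder a ha] at this
      exact right_ne_zero_of_mul this

end

end

/-! ### Double exponential decay in the strip and on the real line -/

section

open Real Set

/-- Combine cos θ ≤ π/2 - θ with Jordan's inequality sin θ ≥ 2θ/π. -/
lemma mul_cos_le {θ : ℝ} (h0 : 0 ≤ θ) (h1 : θ ≤ π / 2) :
    θ * cos θ ≤ ((π / 2) ^ 2 - θ ^ 2) * sin θ := by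
  have hc : cos θ ≤ π / 2 - θ := by
    rw [← sin_pi_div_two_sub]; exact sin_le (by linarith)
  have hs : 2 / π * θ ≤ sin θ := mul_le_sin h0 h1
  have hpi := pi_pos
  calc θ * cos θ ≤ θ * (π / 2 - θ) := by gcongr
    _ ≤ θ * (π / 2 - θ) * (1 + 2 / π * θ) :=
        le_mul_of_one_le_right (mul_nonneg h0 (by linarith))
          (by have : 0 ≤ 2 / π * θ := by positivity
              linarith)
    _ = ((π / 2) ^ 2 - θ ^ 2) * (2 / π * θ) := by field_simp; ring
    _ ≤ _ := by gcongr; nlinarith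

/-- With θ = (π/2) sin y, the left side is at most sin θ + θ cos θ (cosh x - 1) by the addition
formula. On the right, cosh t ≥ 1 + t²/2 with t² = ((π/2)² - θ²)(cosh² x - 1), and `mul_cos_le`
compares the two. -/
lemma abs_sin_mul_cosh_le {y : ℝ} (hy0 : 0 ≤ y) (hy : y < π / 2) (x : ℝ) :
    |sin (π / 2 * (cosh x * sin y))| ≤
      cosh (π / 2 * (sinh x * cos y)) * sin (π / 2 * sin y) := by
  have hpi := pi_pos
  have hs0 : 0 ≤ sin y := sin_nonneg_of_nonneg_of_le_pi hy0 (by linarith)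
  obtain ⟨θ, hθ⟩ : ∃ θ, θ = π / 2 * sin y := ⟨_, rfl⟩
  have hθ0 : 0 ≤ θ := by rw [hθ]; positivity
  have hθ1 : θ ≤ π / 2 := by rw [hθ]; nlinarith [sin_le_one y]
  have hsin : 0 ≤ sin θ := sin_nonneg_of_nonneg_of_le_pi hθ0 (by linarith)
  have hcos : 0 ≤ cos θ := cos_nonneg_of_mem_Icc ⟨by linarith, hθ1⟩
  have hc1 : 0 ≤ cosh x - 1 := by linarith [one_le_cosh x]
  have e : π / 2 * (cosh x * sin y) = θ + θ * (cosh x - 1) := by rw [hθ]; ring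
  have h1 : |sin (θ + θ * (cosh x - 1))| ≤ sin θ + cos θ * (θ * (cosh x - 1)) := by
    rw [sin_add]
    refine (abs_add_le _ _).trans ?_
    rw [abs_mul, abs_mul, abs_of_nonneg hsin, abs_of_nonneg hcos]
    have h2 := abs_cos_le_one (θ * (cosh x - 1))
    have h3 : |sin (θ * (cosh x - 1))| ≤ θ * (cosh x - 1) := by
      have := abs_sin_le_abs (x := θ * (cosh x - 1))
      rwa [abs_of_nonneg (mul_nonneg hθ0 hc1)] at this
    nlinarith
  have h4 : 1 + (π / 2 * (sinh x * cos y)) ^ 2 / 2 ≤ cosh (π / 2 * (sinh x * cos y)) := by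
    set t := π / 2 * (sinh x * cos y)
    have h5 : cosh t = 1 + 2 * sinh (t / 2) ^ 2 := by
      have := cosh_sq (t / 2)
      have h6 := cosh_two_mul (t / 2)
      rw [show 2 * (t / 2) = t by ring] at h6
      linarith
    have h7 : (t / 2) ^ 2 ≤ sinh (t / 2) ^ 2 := by
      rw [sq_le_sq, abs_sinh]
      exact self_le_sinh_iff.2 (abs_nonneg _)
    nlinarith
  have h8 : (π / 2 * (sinh x * cos y)) ^ 2 = ((π / 2) ^ 2 - θ ^ 2) * (cosh x ^ 2 - 1) := by
    have := cosh_sq x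
    have h9 := sin_sq_add_cos_sq y
    rw [hθ, this]
    have : cos y ^ 2 = 1 - sin y ^ 2 := by linarith
    linear_combination (π / 2) ^ 2 * sinh x ^ 2 * this
  have h9 := mul_cos_le hθ0 hθ1
  have h10 : 0 ≤ ((π / 2) ^ 2 - θ ^ 2) := by nlinarith
  rw [e, ← hθ]
  refine h1.trans ?_
  calc sin θ + cos θ * (θ * (cosh x - 1))
      = sin θ + (θ * cos θ) * (cosh x - 1) := by ring
    _ ≤ sin θ + (((π / 2) ^ 2 - θ ^ 2) * sin θ) * (cosh x - 1) := by gcongr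
    _ ≤ sin θ + (((π / 2) ^ 2 - θ ^ 2) * sin θ) * ((cosh x - 1) * ((cosh x + 1) / 2)) := by
        gcongr
        nlinarith
    _ = (1 + ((π / 2) ^ 2 - θ ^ 2) * (cosh x ^ 2 - 1) / 2) * sin θ := by ring
    _ ≤ _ := by rw [← h8]; gcongr

lemma sin_mul_cosh_sq_le {y : ℝ} (hy : |y| < π / 2) (x : ℝ) :
    sin (π / 2 * (cosh x * sin y)) ^ 2 ≤
      cosh (π / 2 * (sinh x * cos y)) ^ 2 * sin (π / 2 * sin y) ^ 2 := by
  have h := abs_sin_mul_cosh_le (abs_nonneg y) hy x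
  rw [cos_abs] at h
  rw [← mul_pow, ← sq_abs]
  rcases abs_choice y with hy' | hy' <;> rw [hy'] at h
  · gcongr
  · simp only [sin_neg, mul_neg, abs_neg] at h
    rw [← neg_sq (_ * sin _)]
    gcongr

lemma norm_one_add_exp_sq (a b : ℝ) :
    ‖1 + Complex.exp (a + b * Complex.I)‖ ^ 2 =
      (1 + exp a) ^ 2 - 4 * exp a * sin (b / 2) ^ 2 := by
  rw [Complex.sq_norm, Complex.normSq_apply]
  have hre : (1 + Complex.exp (a + b * Complex.I)).re = 1 + exp a * cos b := by
    simp [Complex.exp_re]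
  have him : (1 + Complex.exp (a + b * Complex.I)).im = exp a * sin b := by
    simp [Complex.exp_im]
  rw [hre, him]
  have h1 := sin_sq_add_cos_sq b
  have h2 : cos b = 1 - 2 * sin (b / 2) ^ 2 := by
    have := cos_two_mul (b / 2)
    have h3 := sin_sq_add_cos_sq (b / 2)
    rw [show 2 * (b / 2) = b by ring] at this
    linarith
  linear_combination exp a ^ 2 * h1 + 2 * exp a * h2

lemma four_mul_exp_mul_cosh_sq (a : ℝ) : 4 * exp a * cosh (a / 2) ^ 2 = (1 + exp a) ^ 2 := by
  have h1 : exp a = exp (a / 2) ^ 2 := by rw [← exp_nat_mul]; ring_nf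
  have h2 : exp (a / 2) * exp (-(a / 2)) = 1 := by rw [← exp_add]; simp
  rw [cosh_eq, h1]
  linear_combination (exp (a / 2) * exp (-(a / 2)) + 1 + 2 * exp (a / 2) ^ 2) * h2

lemma cos_half_pi_sin_pos {y : ℝ} (hy : |y| < π / 2) : 0 < cos (π / 2 * sin y) := by
  have hpi := pi_pos
  obtain ⟨h1, h2⟩ := abs_lt.1 hy
  have hs1 : sin y < 1 := by
    have := strictMonoOn_sin ⟨h1.le, h2.le⟩ ⟨by linarith, le_rfl⟩ h2
    rwa [sin_pi_div_two] at this
  have hs2 : -1 < sin y := by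
    have := strictMonoOn_sin ⟨le_rfl, by linarith⟩ ⟨h1.le, h2.le⟩ h1
    rwa [sin_neg, sin_pi_div_two] at this
  exact cos_pos_of_mem_Ioo ⟨by nlinarith, by nlinarith⟩

/-- Lower bound for the double exponential factor in a horizontal strip. -/
lemma le_norm_one_add_exp_pi_sinh {y : ℝ} (hy : |y| < π / 2) (x : ℝ) :
    (1 + exp (π * sinh x * cos y)) * cos (π / 2 * sin y) ≤
      ‖1 + Complex.exp (π * Complex.sinh (x + y * Complex.I))‖ := by
  have hc := cos_half_pi_sin_pos hy
  have e : (π * Complex.sinh (x + y * Complex.I) : ℂ) =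
      ((π * sinh x * cos y : ℝ) : ℂ) + ((π * cosh x * sin y : ℝ) : ℂ) * Complex.I := by
    rw [Complex.sinh_add, Complex.cosh_mul_I, Complex.sinh_mul_I]
    push_cast; ring
  rw [e]
  refine le_of_sq_le_sq ?_ (norm_nonneg _)
  rw [norm_one_add_exp_sq]
  have h1 := sin_mul_cosh_sq_le hy x
  have h2 := four_mul_exp_mul_cosh_sq (π * sinh x * cos y)
  have h3 := sin_sq_add_cos_sq (π / 2 * sin y)
  rw [show π / 2 * (cosh x * sin y) = π * cosh x * sin y / 2 by ring,
    show π / 2 * (sinh x * cos y) = π * sinh x * cos y / 2 by ring] at h1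
  -- With a = π sinh x cos y, multiplying by 4eᵃ turns cosh²(a/2) into (1 + eᵃ)², so the quantity
  -- subtracted in the squared norm is at most (1 + eᵃ)² sin²((π/2) sin y).
  have h4 := mul_le_mul_of_nonneg_left h1
    (mul_nonneg (by norm_num : (0 : ℝ) ≤ 4) (exp_pos (π * sinh x * cos y)).le)
  rw [← mul_assoc, h2] at h4
  have h5 : ((1 + exp (π * sinh x * cos y)) * cos (π / 2 * sin y)) ^ 2 =
      (1 + exp (π * sinh x * cos y)) ^ 2 * (1 - sin (π / 2 * sin y) ^ 2) := by
    rw [mul_pow, ← h3]; ring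
  rw [h5]
  linarith

lemma exp_mul_le_rpow_mul_rpow {α β μ : ℝ} (hμ : 0 ≤ μ) (hα : μ ≤ α) (hβ : μ ≤ β) (s : ℝ) :
    exp (μ * |s|) ≤ (1 + exp (-s)) ^ α * (1 + exp s) ^ β := by
  have h1 : 1 ≤ 1 + exp (-s) := by linarith [exp_pos (-s)]
  have h2 : 1 ≤ 1 + exp s := by linarith [exp_pos s]
  have h3 {t : ℝ} : exp (μ * t) ≤ (1 + exp t) ^ μ := by
    rw [mul_comm, exp_mul]
    exact rpow_le_rpow (exp_pos t).le (by linarith) hμ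
  rcases abs_cases s with ⟨h, -⟩ | ⟨h, -⟩ <;> rw [h]
  · calc exp (μ * s) ≤ (1 + exp s) ^ μ := h3
      _ ≤ (1 + exp s) ^ β := rpow_le_rpow_of_exponent_le h2 hβ
      _ ≤ _ := le_mul_of_one_le_left (by positivity) (one_le_rpow h1 (hμ.trans hα))
  · calc exp (μ * -s) ≤ (1 + exp (-s)) ^ μ := h3
      _ ≤ (1 + exp (-s)) ^ α := rpow_le_rpow_of_exponent_le h1 hα
      _ ≤ _ := le_mul_of_one_le_right (by positivity) (one_le_rpow h2 (hμ.trans hβ))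

/-- Decay of a function of the class `LDE` along a horizontal line. -/
lemma norm_le_of_mem_LDE {L R α β d : ℝ} (hL : 0 < L) (hα : 0 < α) (hβ : 0 < β)
    (hd' : d < π / 2) {F : ℂ → ℂ} (hF : F ∈ LDE L R α β d) {y : ℝ} (hy : |y| < d) (x : ℝ) :
    ‖F (x + y * Complex.I)‖ ≤
      L / cos (π / 2 * sin y) ^ (α + β) * exp (-(π * min α β * cos y * |sinh x|)) := by
  have hy' : |y| < π / 2 := hy.trans hd'
  have hc := cos_half_pi_sin_pos hy'
  have hcy : 0 < cos y := cos_pos_of_mem_Ioo (abs_lt.1 hy')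
  have hstrip : (x + y * Complex.I : ℂ) ∈ strip d := by simpa [strip] using hy
  refine (hF.2.1 _ hstrip).trans ?_
  have h1 := le_norm_one_add_exp_pi_sinh hy' x
  -- The same bound at -ζ handles the other factor, since sinh is odd.
  have h2 := le_norm_one_add_exp_pi_sinh (y := -y) (by rwa [abs_neg]) (-x)
  rw [show ((-x : ℝ) + (-y : ℝ) * Complex.I : ℂ) = -(x + y * Complex.I) by push_cast; ring,
    Complex.sinh_neg, mul_neg, sinh_neg, cos_neg, sin_neg, mul_neg, mul_neg, cos_neg, neg_mul] at h2
  have h3 := exp_mul_le_rpow_mul_rpow (lt_min hα hβ).le (min_le_left α β) (min_le_right α β)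
    (π * sinh x * cos y)
  rw [div_mul_eq_mul_div, div_le_div_iff₀ ?_ (by positivity), exp_neg]
  · rw [mul_assoc]
    gcongr
    rw [← div_eq_inv_mul, le_div_iff₀ (exp_pos _)]
    calc cos (π / 2 * sin y) ^ (α + β) * exp (π * min α β * cos y * |sinh x|)
        = cos (π / 2 * sin y) ^ (α + β) * exp (min α β * |π * sinh x * cos y|) := by
          rw [abs_mul, abs_mul, abs_of_pos pi_pos, abs_of_pos hcy]; ring_nf
      _ ≤ cos (π / 2 * sin y) ^ (α + β) * ((1 + exp (-(π * sinh x * cos y))) ^ α *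
          (1 + exp (π * sinh x * cos y)) ^ β) := by gcongr
      _ = ((1 + exp (-(π * sinh x * cos y))) * cos (π / 2 * sin y)) ^ α *
          ((1 + exp (π * sinh x * cos y)) * cos (π / 2 * sin y)) ^ β := by
          rw [mul_rpow (by positivity) hc.le, mul_rpow (by positivity) hc.le, rpow_add hc]; ring
      _ ≤ _ := by gcongr
  · have hp1 : 0 < (1 + exp (π * sinh x * cos y)) * cos (π / 2 * sin y) := by positivity
    have hp2 : 0 < (1 + exp (-(π * sinh x * cos y))) * cos (π / 2 * sin y) := by positivity
    exact mul_pos (rpow_pos_of_pos (hp2.trans_le h2) _) (rpow_pos_of_pos (hp1.trans_le h1) _)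

lemma norm_ofReal_le_of_mem_LDE {L R α β d : ℝ} (hR : 0 < R) (hα : 0 < α) (hβ : 0 < β)
    {F : ℂ → ℂ} (hF : F ∈ LDE L R α β d) (x : ℝ) :
    ‖F x‖ ≤ R * exp (-(π * β * sinh x)) ∧ ‖F x‖ ≤ R * exp (-(π * α * sinh (-x))) := by
  have hx := hF.2.2 x
  have h1 : 1 ≤ 1 + exp (-(π * sinh x)) := by linarith [exp_pos (-(π * sinh x))]
  have h2 : 1 ≤ 1 + exp (π * sinh x) := by linarith [exp_pos (π * sinh x)]
  have h3 {t γ : ℝ} (hγ : 0 < γ) : exp (γ * t) ≤ (1 + exp t) ^ γ := by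
    rw [mul_comm, exp_mul]
    exact rpow_le_rpow (exp_pos t).le (by linarith) hγ.le
  constructor <;> refine hx.trans ?_
  · rw [exp_neg (π * β * sinh x), ← div_eq_mul_inv]
    gcongr
    rw [show π * β * sinh x = β * (π * sinh x) by ring]
    exact (h3 hβ).trans (le_mul_of_one_le_left (by positivity) (one_le_rpow h1 hα.le))
  · rw [exp_neg (π * α * sinh (-x)), ← div_eq_mul_inv]
    gcongr
    rw [sinh_neg, show π * α * -sinh x = α * -(π * sinh x) by ring]
    exact (h3 hα).trans (le_mul_of_one_le_right (by positivity) (one_le_rpow h2 hβ.le))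

end

/-! ### Truncation error -/

section

open Real Set

lemma mul_cosh_le_sinh_sub {x h : ℝ} (hx : 0 ≤ x) (hh : 0 ≤ h) :
    h * cosh x ≤ sinh (x + h) - sinh x := by
  rw [sinh_add]
  have h1 := one_le_cosh h
  have h2 := self_le_sinh_iff.2 hh
  have h3 := sinh_nonneg_iff.2 hx
  nlinarith [cosh_pos x]

/-- By sinh(y + h) - sinh y ≥ h cosh y ≥ h cosh x and 1 + v ≤ exp v. Fixing x at the start of a tail
gives every term the same prefactor, so the differences telescope. -/
lemma exp_neg_sinh_step {b h x y : ℝ} (hb : 0 ≤ b) (hh : 0 ≤ h) (hx : 0 ≤ x) (hxy : x ≤ y) :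
    b * h * cosh x * exp (-(b * sinh (y + h))) ≤
      exp (-(b * sinh y)) - exp (-(b * sinh (y + h))) := by
  have h1 := mul_cosh_le_sinh_sub (hx.trans hxy) hh
  have h2 : cosh x ≤ cosh y := cosh_le_cosh.2 (abs_le_abs_of_nonneg hx hxy)
  have h3 : b * h * cosh x ≤ b * (sinh (y + h) - sinh y) := by
    rw [mul_assoc]; gcongr; exact (mul_le_mul_of_nonneg_left h2 hh).trans h1
  have h4 := add_one_le_exp (b * (sinh (y + h) - sinh y))
  have h5 : exp (-(b * sinh y)) =
      exp (b * (sinh (y + h) - sinh y)) * exp (-(b * sinh (y + h))) := by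
    rw [← exp_add]; ring_nf
  rw [h5]
  nlinarith [exp_pos (-(b * sinh (y + h)))]

/-- Tail bound for a sum with double exponential decay. -/
lemma sum_tail_le {b h R : ℝ} (hb : 0 < b) (hh : 0 < h) (hR : 0 ≤ R) (c : ℕ → ℝ) (N : ℕ)
    (hc : ∀ k, c k ≤ R * exp (-(b * sinh (k * h)))) (j : ℕ) :
    ∑ i ∈ Finset.range j, c (N + i + 1) ≤
      R / (b * h * cosh (N * h)) * exp (-(b * sinh (N * h))) := by
  -- Keeping the subtracted end term makes the statement inductive in j.
  suffices H : ∑ i ∈ Finset.range j, c (N + i + 1) ≤ R / (b * h * cosh (N * h)) *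
      (exp (-(b * sinh (N * h))) - exp (-(b * sinh ((N + j : ℕ) * h)))) by
    refine H.trans ?_
    have := cosh_pos (N * h)
    gcongr
    linarith [exp_pos (-(b * sinh ((N + j : ℕ) * h)))]
  have hp : 0 < b * h * cosh (N * h) := mul_pos (mul_pos hb hh) (cosh_pos _)
  induction j with
  | zero => simp
  | succ j ih =>
    rw [Finset.sum_range_succ]
    have h1 := exp_neg_sinh_step (x := N * h) (y := (N + j : ℕ) * h) hb.le hh.le (by positivity)
      (by gcongr; omega)
    have h2 := hc (N + j + 1)
    have e : ((N + j + 1 : ℕ) : ℝ) * h = (N + j : ℕ) * h + h := by push_cast; ring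
    rw [e] at h2
    rw [← add_assoc, e]
    have h3 : R * exp (-(b * sinh ((N + j : ℕ) * h + h))) ≤ R / (b * h * cosh (N * h)) *
        (exp (-(b * sinh ((N + j : ℕ) * h))) - exp (-(b * sinh ((N + j : ℕ) * h + h)))) := by
      rw [div_mul_eq_mul_div, le_div_iff₀ hp]
      calc _ = R * (b * h * cosh (N * h) * exp (-(b * sinh ((N + j : ℕ) * h + h)))) := by ring
        _ ≤ _ := by gcongr
    calc _ ≤ _ := add_le_add ih (h2.trans h3)
      _ = _ := by ring

lemma abs_nsinc_le_one (x : ℝ) : |nsinc x| ≤ 1 := by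
  rw [nsinc, abs_le]; exact ⟨neg_one_le_sinc _, sinc_le_one _⟩

lemma sincApprox_succ_right (F : ℂ → ℂ) (h : ℝ) (M N : ℕ) (x : ℝ) :
    sincApprox F h M (N + 1 : ℕ) x = sincApprox F h M N x +
      F ((((N + 1 : ℕ) : ℝ) * h : ℝ) : ℂ) * (nsinc ((x - ((N + 1 : ℕ) : ℝ) * h) / h) : ℂ) := by
  have : Finset.Icc (-(M : ℤ)) ((N + 1 : ℕ) : ℤ) =
      insert ((N + 1 : ℕ) : ℤ) (Finset.Icc (-(M : ℤ)) N) := by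
    ext k; simp only [Finset.mem_Icc, Finset.mem_insert]; omega
  rw [sincApprox, this, Finset.sum_insert (by simp), add_comm]
  simp [sincApprox]

lemma sincApprox_succ_left (F : ℂ → ℂ) (h : ℝ) (M N : ℕ) (x : ℝ) :
    sincApprox F h (M + 1 : ℕ) N x = sincApprox F h M N x +
      F ((-((M + 1 : ℕ) : ℝ) * h : ℝ) : ℂ) * (nsinc ((x - -((M + 1 : ℕ) : ℝ) * h) / h) : ℂ) := by
  have : Finset.Icc (-((M + 1 : ℕ) : ℤ)) N =
      insert (-((M + 1 : ℕ) : ℤ)) (Finset.Icc (-(M : ℤ)) N) := by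
    ext k; simp only [Finset.mem_Icc, Finset.mem_insert]; omega
  rw [sincApprox, this, Finset.sum_insert (by simp), add_comm]
  simp [sincApprox]

lemma norm_sincApprox_extend_right (F : ℂ → ℂ) (h : ℝ) (M N j : ℕ) (x : ℝ) :
    ‖sincApprox F h M (N + j : ℕ) x - sincApprox F h M N x‖ ≤
      ∑ i ∈ Finset.range j, ‖F ((((N + i + 1 : ℕ) : ℝ) * h : ℝ) : ℂ)‖ := by
  induction j with
  | zero => simp
  | succ j ih =>
    rw [Finset.sum_range_succ, ← add_assoc, sincApprox_succ_right, add_sub_right_comm]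
    refine (norm_add_le _ _).trans (add_le_add ih ?_)
    rw [norm_mul, Complex.norm_real]
    exact mul_le_of_le_one_right (norm_nonneg _) (abs_nsinc_le_one _)

lemma norm_sincApprox_extend_left (F : ℂ → ℂ) (h : ℝ) (M N j : ℕ) (x : ℝ) :
    ‖sincApprox F h (M + j : ℕ) N x - sincApprox F h M N x‖ ≤
      ∑ i ∈ Finset.range j, ‖F ((-((M + i + 1 : ℕ) : ℝ) * h : ℝ) : ℂ)‖ := by
  induction j with
  | zero => simp
  | succ j ih =>
    rw [Finset.sum_range_succ, ← add_assoc, sincApprox_succ_left, add_sub_right_comm]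
    refine (norm_add_le _ _).trans (add_le_add ih ?_)
    rw [norm_mul, Complex.norm_real]
    exact mul_le_of_le_one_right (norm_nonneg _) (abs_nsinc_le_one _)

/-- The truncation error of the Sinc approximation. -/
lemma norm_sincApprox_sub_le {L R α β d h : ℝ} (hR : 0 < R) (hα : 0 < α) (hβ : 0 < β)
    (hh : 0 < h) {F : ℂ → ℂ} (hF : F ∈ LDE L R α β d) {M N K : ℕ} (hM : M ≤ K) (hN : N ≤ K)
    (x : ℝ) :
    ‖sincApprox F h K K x - sincApprox F h M N x‖ ≤
      R / (π * α * h * cosh (M * h)) * exp (-(π * α * sinh (M * h))) +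
        R / (π * β * h * cosh (N * h)) * exp (-(π * β * sinh (N * h))) := by
  obtain ⟨i, rfl⟩ := Nat.exists_eq_add_of_le hM
  obtain ⟨j, hj⟩ := Nat.exists_eq_add_of_le hN
  have h1 := norm_sincApprox_extend_left F h M (M + i) i x
  have h2 := norm_sincApprox_extend_right F h M N j x
  rw [← hj] at h2
  have h3 := sum_tail_le (mul_pos pi_pos hα) hh hR.le
    (fun k => ‖F ((-((k : ℕ) : ℝ) * h : ℝ) : ℂ)‖) M (fun k => by
      have := (norm_ofReal_le_of_mem_LDE hR hα hβ hF (-(k : ℝ) * h)).2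
      rwa [neg_mul, neg_neg, ← neg_mul] at this) i
  have h4 := sum_tail_le (mul_pos pi_pos hβ) hh hR.le
    (fun k => ‖F ((((k : ℕ) : ℝ) * h : ℝ) : ℂ)‖) N (fun k =>
      (norm_ofReal_le_of_mem_LDE hR hα hβ hF ((k : ℝ) * h)).1) j
  rw [← sub_add_sub_cancel _ (sincApprox F h M (M + i : ℕ) x)]
  exact (norm_add_le _ _).trans (add_le_add (h1.trans h3) (h2.trans h4))

end

/-! ### Discretization error by contour integration -/

section

open Set

lemma norm_sin_sq (a b : ℝ) :
    ‖Complex.sin (a + b * Complex.I)‖ ^ 2 = Real.sin a ^ 2 + Real.sinh b ^ 2 := by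
  have e : Complex.sin (a + b * Complex.I) = ((Real.sin a * Real.cosh b : ℝ) : ℂ) +
      ((Real.cos a * Real.sinh b : ℝ) : ℂ) * Complex.I := by
    rw [Complex.sin_add, Complex.cos_mul_I, Complex.sin_mul_I]
    push_cast; ring
  rw [e, Complex.sq_norm, Complex.normSq_add_mul_I]
  have h1 := Real.cosh_sq b
  have h2 := Real.sin_sq_add_cos_sq a
  linear_combination Real.sin a ^ 2 * h1 + Real.sinh b ^ 2 * h2

lemma one_le_norm_sin_of_sq_eq_one {a : ℝ} (ha : Real.sin a ^ 2 = 1) (b : ℝ) :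
    1 ≤ ‖Complex.sin (a + b * Complex.I)‖ := by
  refine le_of_sq_le_sq ?_ (norm_nonneg _)
  rw [norm_sin_sq, ha]
  linarith [sq_nonneg (Real.sinh b)]

lemma differentiableOn_of_mem_LDE {L R α β d : ℝ} {F : ℂ → ℂ} (hF : F ∈ LDE L R α β d) :
    DifferentiableOn ℂ F (strip d) := hF.1.differentiableOn

lemma isOpen_strip (d : ℝ) : IsOpen (strip d) :=
  isOpen_lt (continuous_abs.comp Complex.continuous_im) continuous_const

lemma cos_int_mul_pi_sq (k : ℤ) : Complex.cos (k * Real.pi) ^ 2 = 1 := by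
  have h := Complex.sin_sq_add_cos_sq (k * Real.pi)
  rwa [Complex.sin_int_mul_pi, zero_pow two_ne_zero, zero_add] at h

lemma nsinc_sub_div {h x : ℝ} (hh : 0 < h) (k : ℤ) (hx : x ≠ k * h) :
    (nsinc ((x - k * h) / h) : ℂ) = Complex.sin (Real.pi * x / h) * Complex.cos (k * Real.pi) /
      (Real.pi / h * (x - k * h)) := by
  have hpi := Real.pi_ne_zero
  have h0 : x - k * h ≠ 0 := sub_ne_zero.2 hx
  have hhc : (h : ℂ) ≠ 0 := by exact_mod_cast hh.ne'
  rw [nsinc, Real.sinc_of_ne_zero (by positivity)]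
  push_cast
  rw [show (Real.pi * ((x - k * h) / h) : ℂ) = Real.pi * x / h - k * Real.pi by field_simp,
    Complex.sin_sub, Complex.sin_int_mul_pi, mul_zero, sub_zero]
  congr 1
  field_simp

/-- The Sinc interpolation error as a contour integral. -/
lemma sin_mul_rectIntegral {d h x y : ℝ} {F : ℂ → ℂ} (hF : DifferentiableOn ℂ F (strip d))
    (hh : 0 < h) (hy : 0 < y) (hyd : y < d) (hx : ∀ k : ℤ, x ≠ k * h) (K : ℕ)
    (hxK : |x| < (K + 1 / 2) * h) {X : ℝ} (hX : X = (K + 1 / 2) * h) :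
    Complex.sin (Real.pi * x / h) *
      rectIntegral (fun ζ => F ζ / (Complex.sin (Real.pi * ζ / h) * (ζ - x)))
        (-X - y * Complex.I) (X + y * Complex.I) =
      2 * Real.pi * Complex.I * (F x - sincApprox F h K K x) := by
  have hpi := Real.pi_ne_zero
  have hpic : (Real.pi : ℂ) ≠ 0 := by exact_mod_cast hpi
  have hhc : (h : ℂ) ≠ 0 := by exact_mod_cast hh.ne'
  have hX0 : 0 < X := by rw [hX]; positivity
  rw [← hX, abs_lt] at hxK
  obtain ⟨z, hz⟩ : ∃ z, z = (-X - y * Complex.I : ℂ) := ⟨_, rfl⟩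
  obtain ⟨w, hw⟩ : ∃ w, w = (X + y * Complex.I : ℂ) := ⟨_, rfl⟩
  have hzre : z.re = -X := by simp [hz]
  have hzim : z.im = -y := by simp [hz]
  have hwre : w.re = X := by simp [hw]
  have hwim : w.im = y := by simp [hw]
  rw [← hz, ← hw]
  have hgrid {k : ℤ} (hk : k ∈ Finset.Icc (-(K : ℤ)) K) : -X < k * h ∧ k * h < X := by
    rw [Finset.mem_Icc] at hk
    have h1 : (-(K : ℝ)) ≤ k := by exact_mod_cast hk.1
    have h2 : (k : ℝ) ≤ K := by exact_mod_cast hk.2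
    rw [hX]
    constructor <;> nlinarith
  obtain ⟨T, hT⟩ : ∃ T, T = (Finset.Icc (-(K : ℤ)) K).image (fun k : ℤ => (k * h : ℂ)) := ⟨_, rfl⟩
  have hxT : (x : ℂ) ∉ T := by
    rw [hT, Finset.mem_image]
    rintro ⟨k, -, hk⟩
    exact hx k (by exact_mod_cast hk.symm)
  have hsx : Complex.sin (Real.pi * x / h) ≠ 0 := by
    rw [Complex.sin_ne_zero_iff]
    intro k hk
    rw [div_eq_iff hhc] at hk
    refine hx k ?_
    have : (x : ℂ) = k * h := mul_left_cancel₀ hpic (by rw [hk]; ring)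
    exact_mod_cast this
  have hder (a : ℂ) : HasDerivAt (fun ζ : ℂ => Complex.sin (Real.pi * ζ / h) * (ζ - x))
      (Complex.cos (Real.pi * a / h) * (Real.pi / h) * (a - x) +
        Complex.sin (Real.pi * a / h)) a := by
    have h1 : HasDerivAt (fun ζ : ℂ => (Real.pi * ζ / h : ℂ)) (Real.pi / h) a := by
      simpa using ((hasDerivAt_id a).const_mul (Real.pi : ℂ)).div_const (h : ℂ)
    exact (h1.csin.mul ((hasDerivAt_id' a).sub_const (x : ℂ))).congr_deriv (by simp)
  have hpk (k : ℤ) : (Real.pi * (k * h) / h : ℂ) = k * Real.pi := by field_simp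
  have hderx : deriv (fun ζ : ℂ => Complex.sin (Real.pi * ζ / h) * (ζ - x)) x =
      Complex.sin (Real.pi * x / h) := by rw [(hder x).deriv]; simp
  have hderk (k : ℤ) : deriv (fun ζ : ℂ => Complex.sin (Real.pi * ζ / h) * (ζ - x)) (k * h) =
      Complex.cos (k * Real.pi) * (Real.pi / h) * (k * h - x) := by
    rw [(hder _).deriv, hpk, Complex.sin_int_mul_pi, add_zero]
  have hcos (k : ℤ) : Complex.cos (k * Real.pi) ≠ 0 := fun h0 => by
    have := cos_int_mul_pi_sq k
    rw [h0] at this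
    norm_num at this
  have hkx (k : ℤ) : (k * h - x : ℂ) ≠ 0 := fun h0 => by
    rw [sub_eq_zero] at h0
    exact hx k (by exact_mod_cast h0.symm)
  have key := rectIntegral_div (z := z) (w := w) (by rw [hzre, hwre]; linarith)
    (by rw [hzim, hwim]; linarith) (isOpen_strip d) (fun ζ hζ => ?_) (insert (x : ℂ) T) hF
    (D := fun ζ : ℂ => Complex.sin (Real.pi * ζ / h) * (ζ - x))
    (fun a _ => (hder a).differentiableAt.differentiableWithinAt) ?_ ?_ ?_ ?_
  · rw [key, Finset.sum_insert hxT, hderx, hT, Finset.sum_image, sincApprox]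
    · have : ∀ k ∈ Finset.Icc (-(K : ℤ)) K,
          F (((k : ℝ) * h : ℝ) : ℂ) * (nsinc ((x - (k : ℝ) * h) / h) : ℂ) =
          -(Complex.sin (Real.pi * x / h) * (F (k * h) /
            deriv (fun ζ : ℂ => Complex.sin (Real.pi * ζ / h) * (ζ - x)) (k * h))) := fun k _ => by
        rw [hderk, nsinc_sub_div hh k (hx k)]
        push_cast
        have h1 := hcos k
        have h2 := hkx k
        have h3 : (x - k * h : ℂ) ≠ 0 := by rw [← neg_sub]; exact neg_ne_zero.2 h2
        have h4 := cos_int_mul_pi_sq k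
        rw [show (k * h - x : ℂ) = -(x - k * h) by ring]
        field_simp
        -- cos(kπ) stands in the numerator of the sinc and in the denominator of the residue;
        -- cos²(kπ) = 1 reconciles them.
        linear_combination F (k * h) * h4
      rw [Finset.sum_congr rfl this, Finset.sum_neg_distrib, ← Finset.mul_sum]
      field_simp
      ring
    · intro k _ l _ hkl
      exact_mod_cast mul_right_cancel₀ hhc hkl
  · have h1 : -y ≤ ζ.im := by rw [← hzim]; exact hζ.2.1
    have h2 : ζ.im ≤ y := by rw [← hwim]; exact hζ.2.2
    exact (abs_le.2 ⟨h1, h2⟩).trans_lt hyd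
  · intro a ha
    rw [Complex.mem_reProdIm, hzre, hwre, hzim, hwim]
    rw [Finset.mem_insert, hT, Finset.mem_image] at ha
    rcases ha with rfl | ⟨k, hk, rfl⟩
    · simpa [hy] using hxK
    · simpa [hy] using hgrid hk
  · intro a ha
    rw [Finset.mem_insert, hT, Finset.mem_image] at ha
    rcases ha with rfl | ⟨k, hk, rfl⟩
    · simp
    · simp [hpk, Complex.sin_int_mul_pi]
  · intro a ha
    rw [Finset.mem_insert, hT, Finset.mem_image] at ha
    rcases ha with rfl | ⟨k, hk, rfl⟩
    · rwa [hderx]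
    · rw [hderk]
      exact mul_ne_zero (mul_ne_zero (hcos k) (div_ne_zero hpic hhc)) (hkx k)
  · intro ζ hζ hζT h0
    rw [Complex.mem_reProdIm, hzre, hwre, hzim, hwim] at hζ
    refine hζT ?_
    rcases mul_eq_zero.1 h0 with h1 | h1
    · obtain ⟨k, hk⟩ := Complex.sin_eq_zero_iff.1 h1
      rw [div_eq_iff hhc] at hk
      have hζk : ζ = k * h := mul_left_cancel₀ hpic (by rw [hk]; ring)
      rw [Finset.mem_insert, hT, Finset.mem_image]
      refine Or.inr ⟨k, ?_, hζk.symm⟩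
      have hre : ζ.re = k * h := by rw [hζk]; simp
      rw [hre, hX] at hζ
      obtain ⟨⟨h2, h3⟩, -⟩ := hζ
      have h4 : (k : ℝ) ≤ K + 1 / 2 := le_of_mul_le_mul_right h3 hh
      have h5 : -(K + 1 / 2 : ℝ) ≤ k := le_of_mul_le_mul_right (by linarith) hh
      rw [Finset.mem_Icc]
      have h6 : (k : ℝ) < ((K + 1 : ℤ) : ℝ) := by push_cast; linarith
      have h7 : ((-(K + 1) : ℤ) : ℝ) < k := by push_cast; linarith
      have h8 := Int.cast_lt.1 h6
      have h9 := Int.cast_lt.1 h7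
      omega
    · rw [sub_eq_zero.1 h1]; exact Finset.mem_insert_self _ _

/-- The weight cosh t makes the primitive explicit on each half-line. Inserting it elsewhere is free
because cosh t ≥ 1. -/
lemma integral_exp_neg_abs_sinh_le {A X : ℝ} (hA : 0 < A) (hX : 0 ≤ X) :
    ∫ t in (-X)..X, Real.exp (-(A * |Real.sinh t|)) * Real.cosh t ≤ 2 / A := by
  have hc : Continuous fun t => Real.exp (-(A * |Real.sinh t|)) * Real.cosh t := by
    have := Real.continuous_sinh
    have := Real.continuous_cosh
    fun_prop
  have hright : ∫ t in (0 : ℝ)..X, Real.exp (-(A * |Real.sinh t|)) * Real.cosh t ≤ 1 / A := by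
    have hd (t : ℝ) : HasDerivAt (fun t => -(Real.exp (-(A * Real.sinh t)) / A))
        (Real.exp (-(A * Real.sinh t)) * Real.cosh t) t := by
      refine ((((Real.hasDerivAt_sinh t).const_mul A).neg.exp).div_const A).neg.congr_deriv ?_
      simp only [Pi.neg_apply]
      field_simp
    have h1 : ∫ t in (0 : ℝ)..X, Real.exp (-(A * |Real.sinh t|)) * Real.cosh t =
        ∫ t in (0 : ℝ)..X, Real.exp (-(A * Real.sinh t)) * Real.cosh t := by
      refine intervalIntegral.integral_congr fun t ht => ?_
      rw [uIcc_of_le hX] at ht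
      simp only [abs_of_nonneg (Real.sinh_nonneg_iff.2 ht.1)]
    rw [h1, intervalIntegral.integral_eq_sub_of_hasDerivAt (fun t _ => hd t)]
    · have : 0 < Real.exp (-(A * Real.sinh X)) / A := by positivity
      simp only [Real.sinh_zero, mul_zero, neg_zero, Real.exp_zero]
      linarith
    · apply Continuous.intervalIntegrable
      have := Real.continuous_sinh
      have := Real.continuous_cosh
      fun_prop
  have hleft : ∫ t in (-X)..0, Real.exp (-(A * |Real.sinh t|)) * Real.cosh t =
      ∫ t in (0 : ℝ)..X, Real.exp (-(A * |Real.sinh t|)) * Real.cosh t := by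
    have := intervalIntegral.integral_comp_neg (a := -X) (b := 0)
      (fun t => Real.exp (-(A * |Real.sinh t|)) * Real.cosh t)
    simpa using this
  rw [← intervalIntegral.integral_add_adjacent_intervals (hc.intervalIntegrable (-X) 0)
    (hc.intervalIntegrable 0 X), hleft]
  calc _ ≤ 1 / A + 1 / A := add_le_add hright hright
    _ = 2 / A := by ring

lemma cos_half_pi_sin_mono {y t : ℝ} (hy : y < Real.pi / 2) (ht : |t| ≤ y) :
    Real.cos (Real.pi / 2 * Real.sin y) ≤ Real.cos (Real.pi / 2 * Real.sin t) := by
  have hpi := Real.pi_pos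
  have hs : Real.sin |t| ≤ Real.sin y := Real.strictMonoOn_sin.monotoneOn
    ⟨by linarith [abs_nonneg t], by linarith⟩ ⟨by linarith [abs_nonneg t], hy.le⟩ ht
  have h0 : 0 ≤ Real.sin |t| :=
    Real.sin_nonneg_of_nonneg_of_le_pi (abs_nonneg t) (by linarith)
  have e : Real.cos (Real.pi / 2 * Real.sin t) = Real.cos (Real.pi / 2 * Real.sin |t|) := by
    rcases abs_choice t with h | h <;> rw [h]
    rw [Real.sin_neg, mul_neg, Real.cos_neg]
  rw [e]
  apply Real.cos_le_cos_of_nonneg_of_le_pi (by positivity)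
  · nlinarith [Real.sin_le_one y]
  · gcongr

lemma norm_horizontal_le {L R α β d h x y : ℝ} (hL : 0 < L) (hα : 0 < α) (hβ : 0 < β)
    (hd' : d < Real.pi / 2) {F : ℂ → ℂ} (hF : F ∈ LDE L R α β d) (hh : 0 < h) {η : ℝ}
    (hy : 0 < y) (hyd : y < d) (hη : |η| = y) {X : ℝ} (hX : 0 ≤ X) :
    ‖∫ t : ℝ in (-X)..X, F (t + η * Complex.I) /
      (Complex.sin (Real.pi * (t + η * Complex.I) / h) * (t + η * Complex.I - x))‖ ≤
      L / Real.cos (Real.pi / 2 * Real.sin y) ^ (α + β) / (Real.sinh (Real.pi * y / h) * y) *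
        (2 / (Real.pi * min α β * Real.cos y)) := by
  have hpi := Real.pi_pos
  have hA : 0 < Real.pi * min α β * Real.cos y :=
    mul_pos (mul_pos hpi (lt_min hα hβ)) (Real.cos_pos_of_mem_Ioo ⟨by linarith, by linarith⟩)
  have hcc := cos_half_pi_sin_pos (y := y) (by rw [abs_of_pos hy]; linarith)
  have hsh : 0 < Real.sinh (Real.pi * y / h) := Real.sinh_pos_iff.2 (by positivity)
  have hcη : Real.cos η = Real.cos y := by rw [← Real.cos_abs, hη]
  have hccη : Real.cos (Real.pi / 2 * Real.sin y) = Real.cos (Real.pi / 2 * Real.sin η) := by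
    rcases abs_choice η with h | h <;> rw [← hη, h]
    rw [Real.sin_neg, mul_neg, Real.cos_neg]
  have hc : Continuous fun t =>
      Real.exp (-(Real.pi * min α β * Real.cos y * |Real.sinh t|)) * Real.cosh t := by
    have := Real.continuous_sinh
    have := Real.continuous_cosh
    fun_prop
  have hbound : ∀ t : ℝ, ‖F (t + η * Complex.I) /
      (Complex.sin (Real.pi * (t + η * Complex.I) / h) * (t + η * Complex.I - x))‖ ≤
      L / Real.cos (Real.pi / 2 * Real.sin y) ^ (α + β) / (Real.sinh (Real.pi * y / h) * y) *
      (Real.exp (-(Real.pi * min α β * Real.cos y * |Real.sinh t|)) * Real.cosh t) := fun t => by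
    have h1 := norm_le_of_mem_LDE hL hα hβ hd' hF (hη.trans_lt hyd) t
    rw [hcη, ← hccη] at h1
    have h2 : Real.sinh (Real.pi * y / h) ≤
        ‖Complex.sin (Real.pi * (t + η * Complex.I) / h)‖ := by
      have e : (Real.pi * (t + η * Complex.I) / h : ℂ) =
          ((Real.pi * t / h : ℝ) : ℂ) + ((Real.pi * η / h : ℝ) : ℂ) * Complex.I := by
        push_cast; ring
      rw [e]
      refine le_of_sq_le_sq ?_ (norm_nonneg _)
      rw [norm_sin_sq]
      have h3 : Real.sinh (Real.pi * y / h) ^ 2 = Real.sinh (Real.pi * η / h) ^ 2 := by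
        rcases abs_choice η with h | h <;> rw [← hη, h]
        rw [mul_neg, neg_div, Real.sinh_neg, neg_sq]
      rw [h3]
      linarith [sq_nonneg (Real.sin (Real.pi * t / h))]
    have h3 : y ≤ ‖(t + η * Complex.I - x : ℂ)‖ := by
      have := Complex.abs_im_le_norm (t + η * Complex.I - x : ℂ)
      simpa [hη] using this
    rw [norm_div, norm_mul]
    calc _ ≤ (L / Real.cos (Real.pi / 2 * Real.sin y) ^ (α + β) *
          Real.exp (-(Real.pi * min α β * Real.cos y * |Real.sinh t|))) /
          (Real.sinh (Real.pi * y / h) * y) := by gcongr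
      _ = L / Real.cos (Real.pi / 2 * Real.sin y) ^ (α + β) / (Real.sinh (Real.pi * y / h) * y) *
          (Real.exp (-(Real.pi * min α β * Real.cos y * |Real.sinh t|)) * 1) := by ring
      _ ≤ _ := by
        gcongr
        exact Real.one_le_cosh t
  calc _ ≤ ∫ t : ℝ in (-X)..X, L / Real.cos (Real.pi / 2 * Real.sin y) ^ (α + β) /
          (Real.sinh (Real.pi * y / h) * y) *
          (Real.exp (-(Real.pi * min α β * Real.cos y * |Real.sinh t|)) * Real.cosh t) :=
        intervalIntegral.norm_integral_le_of_norm_le (by linarith)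
          (Filter.Eventually.of_forall fun t _ => hbound t)
          (Continuous.intervalIntegrable (by fun_prop) _ _)
    _ ≤ _ := by
      rw [intervalIntegral.integral_const_mul]
      gcongr
      exact integral_exp_neg_abs_sinh_le hA hX

/-- Midway between nodes the complex sine has modulus at least 1. A crude bound on F then suffices,
as the distance |ξ| - |x| in the denominator makes the side negligible as |ξ| grows. -/
lemma norm_vertical_le {L R α β d h x y : ℝ} (hL : 0 < L) (hα : 0 < α) (hβ : 0 < β)
    (hd' : d < Real.pi / 2) {F : ℂ → ℂ} (hF : F ∈ LDE L R α β d) {ξ : ℝ}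
    (hy : 0 < y) (hyd : y < d) (hξ : Real.sin (Real.pi * ξ / h) ^ 2 = 1) (hxξ : |x| < |ξ|) :
    ‖∫ t : ℝ in (-y)..y, F (ξ + t * Complex.I) /
      (Complex.sin (Real.pi * (ξ + t * Complex.I) / h) * (ξ + t * Complex.I - x))‖ ≤
      L / Real.cos (Real.pi / 2 * Real.sin y) ^ (α + β) / (|ξ| - |x|) * (2 * y) := by
  have hpi := Real.pi_pos
  have hcc := cos_half_pi_sin_pos (y := y) (by rw [abs_of_pos hy]; linarith)
  have hb : ∀ t ∈ Set.uIoc (-y) y, ‖F (ξ + t * Complex.I) /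
      (Complex.sin (Real.pi * (ξ + t * Complex.I) / h) * (ξ + t * Complex.I - x))‖ ≤
      L / Real.cos (Real.pi / 2 * Real.sin y) ^ (α + β) / (|ξ| - |x|) := fun t ht => by
    rw [uIoc_of_le (by linarith)] at ht
    have hty : |t| ≤ y := abs_le.2 ⟨ht.1.le, ht.2⟩
    have h1 := norm_le_of_mem_LDE hL hα hβ hd' hF (hty.trans_lt hyd) ξ
    have hct : 0 < Real.cos t := Real.cos_pos_of_mem_Ioo (abs_lt.1 (by linarith))
    have h2 : ‖F (ξ + t * Complex.I)‖ ≤ L / Real.cos (Real.pi / 2 * Real.sin y) ^ (α + β) := by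
      refine h1.trans ?_
      have h3 := cos_half_pi_sin_mono (hyd.trans hd') hty
      have h4 : 0 < min α β := lt_min hα hβ
      calc _ ≤ L / Real.cos (Real.pi / 2 * Real.sin t) ^ (α + β) * 1 := by
            have := hcc.trans_le h3
            gcongr
            rw [Real.exp_le_one_iff, neg_nonpos]
            positivity
        _ ≤ _ := by
            rw [mul_one]
            gcongr
    have h3 : 1 ≤ ‖Complex.sin (Real.pi * (ξ + t * Complex.I) / h)‖ := by
      have e : (Real.pi * (ξ + t * Complex.I) / h : ℂ) =
          ((Real.pi * ξ / h : ℝ) : ℂ) + ((Real.pi * t / h : ℝ) : ℂ) * Complex.I := by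
        push_cast; ring
      rw [e]
      exact one_le_norm_sin_of_sq_eq_one hξ _
    have h4 : |ξ| - |x| ≤ ‖(ξ + t * Complex.I - x : ℂ)‖ := by
      have h5 := Complex.abs_re_le_norm (ξ + t * Complex.I - x : ℂ)
      have h6 := abs_sub_abs_le_abs_sub ξ x
      simp only [Complex.sub_re, Complex.add_re, Complex.ofReal_re, Complex.re_ofReal_mul,
        Complex.I_re, mul_zero, add_zero] at h5
      linarith
    have h5 : 0 < |ξ| - |x| := by linarith
    rw [norm_div, norm_mul]
    calc _ ≤ L / Real.cos (Real.pi / 2 * Real.sin y) ^ (α + β) / (1 * (|ξ| - |x|)) := by gcongr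
      _ = _ := by rw [one_mul]
  refine (intervalIntegral.norm_integral_le_of_norm_le_const hb).trans_eq ?_
  rw [abs_of_pos (show 0 < y - -y by linarith)]
  ring

lemma sin_half_int_sq {h : ℝ} (hh : 0 < h) (K : ℕ) :
    Real.sin (Real.pi * ((K + 1 / 2) * h) / h) ^ 2 = 1 := by
  have e : Real.pi * ((K + 1 / 2) * h) / h = K * Real.pi + Real.pi / 2 := by field_simp
  rw [e, Real.sin_add_pi_div_two]
  have := Real.sin_sq_add_cos_sq (K * Real.pi)
  rwa [Real.sin_nat_mul_pi, zero_pow two_ne_zero, zero_add] at this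

lemma sincApprox_grid (F : ℂ → ℂ) {h : ℝ} (hh : 0 < h) (j : ℤ) {M N : ℤ}
    (hj : j ∈ Finset.Icc (-M) N) : sincApprox F h M N (j * h) = F ((j * h : ℝ) : ℂ) := by
  rw [sincApprox, Finset.sum_eq_single_of_mem j hj]
  · simp [nsinc]
  · intro k _ hkj
    have : nsinc ((j * h - k * h) / h) = 0 := by
      have e : Real.pi * ((j * h - k * h) / h) = ((j - k : ℤ) : ℝ) * Real.pi := by
        push_cast; field_simp
      have h0 : ((j - k : ℤ) : ℝ) ≠ 0 := by exact_mod_cast sub_ne_zero.2 hkj.symm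
      rw [nsinc, e, Real.sinc_of_ne_zero (mul_ne_zero h0 Real.pi_ne_zero), Real.sin_int_mul_pi,
        zero_div]
    rw [this, Complex.ofReal_zero, mul_zero]

/-- The discretization error of the symmetrically truncated Sinc approximation. -/
lemma norm_sub_sincApprox_le {L R α β d h x y : ℝ} (hL : 0 < L) (hα : 0 < α) (hβ : 0 < β)
    (hd' : d < Real.pi / 2) {F : ℂ → ℂ} (hF : F ∈ LDE L R α β d) (hh : 0 < h)
    (hy : 0 < y) (hyd : y < d) (K : ℕ) (hxK : |x| < (K + 1 / 2) * h) :
    ‖F x - sincApprox F h K K x‖ ≤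
      2 * L / (Real.pi * (Real.pi * min α β * Real.cos y) *
        Real.cos (Real.pi / 2 * Real.sin y) ^ (α + β) * (Real.sinh (Real.pi * y / h) * y)) +
      L / Real.cos (Real.pi / 2 * Real.sin y) ^ (α + β) * (2 * y) / Real.pi *
        ((K + 1 / 2) * h - |x|)⁻¹ := by
  have hpi := Real.pi_pos
  have hcc := cos_half_pi_sin_pos (y := y) (by rw [abs_of_pos hy]; linarith)
  have hcy : 0 < Real.cos y := Real.cos_pos_of_mem_Ioo ⟨by linarith, by linarith⟩
  have hμ : 0 < min α β := lt_min hα hβ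
  have hsh : 0 < Real.sinh (Real.pi * y / h) := Real.sinh_pos_iff.2 (by positivity)
  have hX : 0 < (K + 1 / 2) * h := by positivity
  have hd0 : 0 < (K + 1 / 2) * h - |x| := by linarith
  -- At a node two poles would coalesce, but there the interpolation is exact.
  by_cases hx : ∃ k : ℤ, x = k * h
  · obtain ⟨k, rfl⟩ := hx
    have hk : k ∈ Finset.Icc (-(K : ℤ)) K := by
      rw [abs_mul, abs_of_pos hh] at hxK
      have h1 := abs_lt.1 (lt_of_mul_lt_mul_right hxK hh.le)
      have h6 : (k : ℝ) < ((K + 1 : ℤ) : ℝ) := by push_cast; linarith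
      have h7 : ((-(K + 1) : ℤ) : ℝ) < k := by push_cast; linarith
      have h8 := Int.cast_lt.1 h6
      have h9 := Int.cast_lt.1 h7
      rw [Finset.mem_Icc]
      omega
    rw [sincApprox_grid F hh k hk, sub_self, norm_zero]
    positivity
  · push Not at hx
    obtain ⟨X, hXe⟩ : ∃ X, X = (K + 1 / 2) * h := ⟨_, rfl⟩
    have e := sin_mul_rectIntegral (differentiableOn_of_mem_LDE hF) hh hy hyd hx K hxK hXe
    rw [← hXe] at hX hd0 hxK ⊢
    have hsX : Real.sin (Real.pi * X / h) ^ 2 = 1 := by rw [hXe]; exact sin_half_int_sq hh K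
    have hs1 : ‖Complex.sin (Real.pi * x / h)‖ ≤ 1 := by
      rw [show (Real.pi * x / h : ℂ) = ((Real.pi * x / h : ℝ) : ℂ) by push_cast; rfl,
        ← Complex.ofReal_sin, Complex.norm_real]
      exact Real.abs_sin_le_one _
    have b1 := norm_horizontal_le (x := x) hL hα hβ hd' hF hh (η := -y) hy hyd
      (by rw [abs_neg, abs_of_pos hy]) hX.le
    have b2 := norm_horizontal_le (x := x) hL hα hβ hd' hF hh (η := y) hy hyd (abs_of_pos hy) hX.le
    have b3 := norm_vertical_le (x := x) hL hα hβ hd' hF (ξ := X) hy hyd hsX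
      (by rwa [abs_of_pos hX])
    have b4 := norm_vertical_le (x := x) hL hα hβ hd' hF (ξ := -X) hy hyd
      (by rwa [mul_neg, neg_div, Real.sin_neg, neg_sq]) (by rwa [abs_neg, abs_of_pos hX])
    rw [abs_neg, abs_of_pos hX] at b4
    rw [abs_of_pos hX] at b3
    have hr : ‖rectIntegral (fun ζ => F ζ / (Complex.sin (Real.pi * ζ / h) * (ζ - x)))
        (-X - y * Complex.I) (X + y * Complex.I)‖ ≤
        2 * (L / Real.cos (Real.pi / 2 * Real.sin y) ^ (α + β) /
          (Real.sinh (Real.pi * y / h) * y) * (2 / (Real.pi * min α β * Real.cos y))) +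
        2 * (L / Real.cos (Real.pi / 2 * Real.sin y) ^ (α + β) / (X - |x|) * (2 * y)) := by
      have e1 : (-X - y * Complex.I : ℂ).re = -X := by simp
      have e2 : (-X - y * Complex.I : ℂ).im = -y := by simp
      have e3 : (X + y * Complex.I : ℂ).re = X := by simp
      have e4 : (X + y * Complex.I : ℂ).im = y := by simp
      rw [rectIntegral, e1, e2, e3, e4]
      refine (norm_sub_le _ _).trans ?_
      refine (add_le_add_left ((norm_add_le _ _).trans
        (add_le_add_left (norm_sub_le _ _) _)) _).trans ?_
      simp only [norm_smul, Complex.norm_I, one_mul]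
      linarith
    have e' : ‖2 * Real.pi * Complex.I * (F x - sincApprox F h K K x)‖ =
        2 * Real.pi * ‖F x - sincApprox F h K K x‖ := by simp [abs_of_pos hpi]
    have hn := (mul_le_of_le_one_left (norm_nonneg _) hs1).trans hr
    rw [← norm_mul, e, e'] at hn
    rw [← le_div_iff₀' (by positivity)] at hn
    refine hn.trans_eq ?_
    field_simp

/-- The error of the Sinc approximation: discretization error plus truncation error. -/
lemma norm_sub_sincApprox_le_add {L R α β d h : ℝ} (hL : 0 < L) (hR : 0 < R) (hα : 0 < α)
    (hβ : 0 < β) (hd : 0 < d) (hd' : d < Real.pi / 2) {F : ℂ → ℂ} (hF : F ∈ LDE L R α β d)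
    (hh : 0 < h) (M N : ℕ) (x : ℝ) :
    ‖F x - sincApprox F h M N x‖ ≤
      2 * L / (Real.pi * (Real.pi * min α β * Real.cos d) *
        Real.cos (Real.pi / 2 * Real.sin d) ^ (α + β) * (Real.sinh (Real.pi * d / h) * d)) +
      (R / (Real.pi * α * h * Real.cosh (M * h)) * Real.exp (-(Real.pi * α * Real.sinh (M * h))) +
        R / (Real.pi * β * h * Real.cosh (N * h)) *
          Real.exp (-(Real.pi * β * Real.sinh (N * h)))) := by
  have hpi := Real.pi_pos
  obtain ⟨B, hB⟩ : ∃ B, B = (R / (Real.pi * α * h * Real.cosh (M * h)) *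
      Real.exp (-(Real.pi * α * Real.sinh (M * h))) + R / (Real.pi * β * h * Real.cosh (N * h)) *
          Real.exp (-(Real.pi * β * Real.sinh (N * h)))) := ⟨_, rfl⟩
  rw [← hB]
  -- F is controlled only in the open strip, so K → ∞ is taken at a fixed height y < d; afterwards y
  -- → d by continuity of the bound.
  have step : ∀ y ∈ Ioo 0 d, ‖F x - sincApprox F h M N x‖ ≤
      2 * L / (Real.pi * (Real.pi * min α β * Real.cos y) *
        Real.cos (Real.pi / 2 * Real.sin y) ^ (α + β) * (Real.sinh (Real.pi * y / h) * y)) + B := by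
    intro y hy
    have hlim : Filter.Tendsto (fun K : ℕ => ((K + 1 / 2) * h - |x| : ℝ)) Filter.atTop
        Filter.atTop := by
      refine Filter.tendsto_atTop_add_const_right _ _ (Filter.Tendsto.atTop_mul_const hh ?_)
      exact Filter.tendsto_atTop_add_const_right _ _ tendsto_natCast_atTop_atTop
    have hlim2 := ((hlim.inv_tendsto_atTop.const_mul
      (L / Real.cos (Real.pi / 2 * Real.sin y) ^ (α + β) * (2 * y) / Real.pi)).const_add
      (2 * L / (Real.pi * (Real.pi * min α β * Real.cos y) *
        Real.cos (Real.pi / 2 * Real.sin y) ^ (α + β) *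
          (Real.sinh (Real.pi * y / h) * y)))).add_const B
    rw [mul_zero, add_zero] at hlim2
    refine ge_of_tendsto hlim2 ?_
    filter_upwards [hlim.eventually_gt_atTop 0, Filter.eventually_ge_atTop (max M N)] with K h1 h2
    rw [← sub_add_sub_cancel _ (sincApprox F h K K x)]
    refine (norm_add_le _ _).trans (add_le_add ?_ ?_)
    · exact norm_sub_sincApprox_le hL hα hβ hd' hF hh hy.1 hy.2 K (by linarith)
    · rw [hB]
      exact norm_sincApprox_sub_le hR hα hβ hh hF ((le_max_left _ _).trans h2)
        ((le_max_right _ _).trans h2) x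
  have hcc := cos_half_pi_sin_pos (y := d) (by rwa [abs_of_pos hd])
  have hcd : 0 < Real.cos d := Real.cos_pos_of_mem_Ioo ⟨by linarith, hd'⟩
  have hμ : 0 < min α β := lt_min hα hβ
  have hsh : 0 < Real.sinh (Real.pi * d / h) := Real.sinh_pos_iff.2 (by positivity)
  have hcont : ContinuousAt (fun y : ℝ => 2 * L / (Real.pi * (Real.pi * min α β * Real.cos y) *
      Real.cos (Real.pi / 2 * Real.sin y) ^ (α + β) * (Real.sinh (Real.pi * y / h) * y)) + B) d := by
    refine ContinuousAt.add (ContinuousAt.div continuousAt_const ?_ (by positivity))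
      continuousAt_const
    refine ContinuousAt.mul (ContinuousAt.mul (by fun_prop) ?_) ?_
    · exact ContinuousAt.rpow_const (by fun_prop) (Or.inl hcc.ne')
    · have : Continuous fun y => Real.sinh (Real.pi * y / h) :=
        Real.continuous_sinh.comp (by fun_prop)
      exact (this.mul continuous_id).continuousAt
  refine ge_of_tendsto (hcont.tendsto.mono_left nhdsWithin_le_nhds : Filter.Tendsto _
    (nhdsWithin d (Iio d)) _) ?_
  filter_upwards [Ioo_mem_nhdsLT hd] with y hy using step y hy

end

/-! ### Choice of the mesh size and the explicit constant -/

section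

open Real

/-- The choice of t gives γ sinh t ≥ μQ for the exponent. As γ ≥ μ, also γ cosh t ≥ μ cosh(arsinh
Q), which with `hx` bounds the denominator below by 2d. -/
lemma truncation_term_le {R d μ γ h Q t : ℝ} (hR : 0 < R) (hd : 0 < d) (hμ : 0 < μ) (hγ : μ ≤ γ)
    (hh : 0 < h) (hQ : 0 < Q) (hx : d / μ ≤ π / 2 * (h * cosh (arsinh Q)))
    (ht : arsinh (μ / γ * Q) ≤ t) :
    R / (π * γ * h * cosh t) * exp (-(π * γ * sinh t)) ≤ R / (2 * d) * exp (-(π * μ * Q)) := by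
  have hpi := pi_pos
  have hγ0 : 0 < γ := hμ.trans_le hγ
  have h0 : 0 ≤ arsinh (μ / γ * Q) := arsinh_nonneg_iff.2 (by positivity)
  have h1 : μ * Q ≤ γ * sinh t := by
    have : μ / γ * Q ≤ sinh t := by
      rw [← sinh_arsinh (μ / γ * Q)]; exact sinh_le_sinh.2 ht
    calc μ * Q = γ * (μ / γ * Q) := by field_simp
      _ ≤ _ := by gcongr
  have h2 : μ * cosh (arsinh Q) ≤ γ * cosh t := by
    have h3 : cosh (arsinh (μ / γ * Q)) ≤ cosh t :=
      cosh_le_cosh.2 (abs_le_abs_of_nonneg h0 ht)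
    refine le_trans ?_ (mul_le_mul_of_nonneg_left h3 hγ0.le)
    refine le_of_sq_le_sq ?_ (mul_pos hγ0 (cosh_pos _)).le
    rw [mul_pow, mul_pow, cosh_sq, cosh_sq, sinh_arsinh, sinh_arsinh]
    have e : γ ^ 2 * ((μ / γ * Q) ^ 2 + 1) = μ ^ 2 * Q ^ 2 + γ ^ 2 := by field_simp
    rw [e]
    nlinarith
  have h4 : 2 * d ≤ π * γ * h * cosh t := by
    rw [div_le_iff₀ hμ] at hx
    calc 2 * d ≤ π * h * (μ * cosh (arsinh Q)) := by linarith
      _ ≤ π * h * (γ * cosh t) := by gcongr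
      _ = _ := by ring
  gcongr ?_ * exp (-?_)
  · gcongr
  · rw [mul_assoc, mul_assoc]; gcongr

lemma inv_sinh_le {s s₀ r r₀ : ℝ} (hs₀ : 0 < s₀) (hs : s₀ ≤ s) (hr : s₀ - r₀ ≤ s - r) :
    1 / sinh s ≤ 2 * (exp (-(s₀ - r₀)) / (1 - exp (-(2 * s₀)))) * exp (-r) := by
  have h1 : sinh s = (1 - exp (-(2 * s))) / (2 * exp (-s)) := by
    rw [sinh_eq, eq_div_iff (by positivity)]
    have h2 : exp s * exp (-s) = 1 := by rw [← exp_add]; simp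
    have h3 : exp (-(2 * s)) = exp (-s) * exp (-s) := by rw [← exp_add]; ring_nf
    rw [h3]
    linear_combination h2
  have h4 : 0 < 1 - exp (-(2 * s₀)) := by
    rw [sub_pos, exp_lt_one_iff]; linarith
  rw [h1, one_div_div]
  calc 2 * exp (-s) / (1 - exp (-(2 * s)))
      ≤ 2 * (exp (-(s₀ - r₀)) * exp (-r)) / (1 - exp (-(2 * s₀))) := by
        rw [← exp_add]
        gcongr
        linarith
    _ = _ := by ring

/-- Stating the conditions on M and N through μ/α and μ/β treats both cases of the minimum at once,
one of the ratios being 1. -/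
lemma norm_sub_sincApprox_le_errorConst {L R α β d : ℝ} (hL : 0 < L) (hR : 0 < R) (hα : 0 < α)
    (hβ : 0 < β) (hd : 0 < d) (hd' : d < π / 2) {F : ℂ → ℂ} (hF : F ∈ LDE L R α β d) {n : ℕ}
    (hn : 1 ≤ n) {μ : ℝ} (hμ : μ = min α β) {h : ℝ} (hh : h = arsinh (q (d * n / μ)) / n)
    {M N : ℕ} (hM : arsinh (μ / α * q (d * n / μ)) ≤ M * h)
    (hN : arsinh (μ / β * q (d * n / μ)) ≤ N * h) (x : ℝ) :
    ‖F x - sincApprox F h M N x‖ ≤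
      errorConst L R α β d * exp (-(π * d * n / arsinh (d * n / μ))) := by
  have hpi := pi_pos
  have hn0 : (0 : ℝ) < n := by exact_mod_cast hn
  have hn1 : (1 : ℝ) ≤ n := by exact_mod_cast hn
  have hμ0 : 0 < μ := by rw [hμ]; exact lt_min hα hβ
  have hX : 0 < d * n / μ := by positivity
  have hQ := q_pos hX
  have hA := arsinh_pos_iff.2 hQ
  have hh0 : 0 < h := by rw [hh]; positivity
  have hnh : arsinh (q (d * n / μ)) = n * h := by rw [hh]; field_simp
  have hle : d / μ ≤ d * n / μ := by
    gcongr; exact le_mul_of_one_le_right hd.le hn1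
  have ha : 0 < d / μ := by positivity
  -- This is `le_arsinh_q_mul_cosh` at dn/μ, divided by n, since arsinh of q(dn/μ) is nh.
  have hx : d / μ ≤ π / 2 * (h * cosh (arsinh (q (d * n / μ)))) := by
    have h1 := le_arsinh_q_mul_cosh hX
    rw [show d * n / μ = n * (d / μ) by ring] at h1 ⊢
    rw [show d * n / μ = n * (d / μ) by ring] at hnh
    rw [hnh] at h1 ⊢
    refine le_of_mul_le_mul_left ?_ hn0
    linarith
  have tM := truncation_term_le hR hd hμ0 (hμ ▸ min_le_left α β) hh0 hQ hx hM
  have tN := truncation_term_le hR hd hμ0 (hμ ▸ min_le_right α β) hh0 hQ hx hN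
  have main := norm_sub_sincApprox_le_add hL hR hα hβ hd hd' hF hh0 M N x
  have hs : π * d / h = π * μ * p (d * n / μ) := by
    rw [p, ← q, hnh]; field_simp
  have hr : π * d * n / arsinh (d * n / μ) = π * μ * q (d * n / μ) := by
    rw [q]
    have := (arsinh_pos_iff.2 hX).ne'
    field_simp
  have hs₀ : 0 < π * μ * p (d / μ) := mul_pos (by positivity) (p_pos ha)
  have hinv := inv_sinh_le (s := π * μ * p (d * n / μ)) (r := π * μ * q (d * n / μ))
    (r₀ := π * μ * q (d / μ)) hs₀ (by gcongr; exact p_le_p ha hle) (by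
      rw [← mul_sub, ← mul_sub]
      exact mul_le_mul_of_nonneg_left (p_sub_q_le ha hle) (by positivity))
  have hcc := cos_half_pi_sin_pos (y := d) (by rwa [abs_of_pos hd])
  have hcd : 0 < cos d := cos_pos_of_mem_Ioo ⟨by linarith, hd'⟩
  have hsh : 0 < sinh (π * μ * p (d * n / μ)) :=
    sinh_pos_iff.2 (mul_pos (by positivity) (p_pos hX))
  rw [hs, ← hμ] at main
  rw [hr]
  refine main.trans ?_
  have hdisc : 2 * L / (π * (π * μ * cos d) * cos (π / 2 * sin d) ^ (α + β) *
      (sinh (π * μ * p (d * n / μ)) * d)) ≤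
      2 / (π * d) * (2 * L * exp (-(π * μ * (p (d / μ) - q (d / μ)))) /
        (π * μ * (1 - exp (-(2 * π * μ * p (d / μ)))) *
          cos (π / 2 * sin d) ^ (α + β) * cos d)) * exp (-(π * μ * q (d * n / μ))) := by
    have e1 : 2 * L / (π * (π * μ * cos d) * cos (π / 2 * sin d) ^ (α + β) *
      (sinh (π * μ * p (d * n / μ)) * d)) =
        2 * L / (π * (π * μ * cos d) * cos (π / 2 * sin d) ^ (α + β) * d) *
          (1 / sinh (π * μ * p (d * n / μ))) := by field_simp
    rw [e1]
    refine (mul_le_mul_of_nonneg_left hinv (by positivity)).trans_eq ?_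
    rw [mul_sub (π * μ), show 2 * π * μ * p (d / μ) = 2 * (π * μ * p (d / μ)) by ring]
    have h4 : 1 - exp (-(2 * (π * μ * p (d / μ)))) ≠ 0 := by
      refine (sub_pos.2 ?_).ne'
      rw [exp_lt_one_iff]; linarith
    field_simp
  have e2 : errorConst L R α β d * exp (-(π * μ * q (d * n / μ))) =
      2 / (π * d) * (2 * L * exp (-(π * μ * (p (d / μ) - q (d / μ)))) /
        (π * μ * (1 - exp (-(2 * π * μ * p (d / μ)))) *
          cos (π / 2 * sin d) ^ (α + β) * cos d)) * exp (-(π * μ * q (d * n / μ))) +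
      (R / (2 * d) * exp (-(π * μ * q (d * n / μ))) +
        R / (2 * d) * exp (-(π * μ * q (d * n / μ)))) := by
    simp only [errorConst, ← hμ]
    have e3 : 2 / (π * d) * (π / 2 * R) = R / (2 * d) + R / (2 * d) := by field_simp; ring
    rw [mul_add, e3]; ring
  rw [e2]
  exact add_le_add hdisc (add_le_add tM tN)

/-- The rounded truncation number is a natural number between `arsinh (γ Q) / h` and `n`. -/
lemma exists_ceil_eq_natCast {n : ℕ} {h Q γ : ℝ} (hh : 0 < h) (hQ : 0 < Q) (hγ : 0 < γ)
    (hγ1 : γ ≤ 1) (hnh : arsinh Q = n * h) :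
    ∃ K : ℕ, ⌈1 / h * arsinh (γ * Q)⌉ = K ∧ K ≤ n ∧ arsinh (γ * Q) ≤ K * h := by
  have h0 : 0 ≤ 1 / h * arsinh (γ * Q) :=
    mul_nonneg (by positivity) (arsinh_nonneg_iff.2 (by positivity))
  obtain ⟨K, hK⟩ := Int.eq_ofNat_of_zero_le (Int.ceil_nonneg h0)
  refine ⟨K, hK, ?_, ?_⟩
  · have : ⌈1 / h * arsinh (γ * Q)⌉ ≤ (n : ℤ) := by
      rw [Int.ceil_le, Int.cast_natCast, one_div, inv_mul_le_iff₀ hh, mul_comm h, ← hnh]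
      exact arsinh_le_arsinh.2 (mul_le_of_le_one_left hQ.le hγ1)
    rw [hK] at this
    exact_mod_cast this
  · have := Int.le_ceil (1 / h * arsinh (γ * Q))
    rw [hK, one_div, inv_mul_le_iff₀ hh, mul_comm h] at this
    exact_mod_cast this

end

end DESinc

theorem theorem2 (L R α β d : ℝ) (hL : 0 < L) (hR : 0 < R) (hα : 0 < α) (hβ : 0 < β)
    (hd : 0 < d) (hd' : d < Real.pi / 2)
    (F : ℂ → ℂ) (hF : F ∈ DESinc.LDE L R α β d)
    (n : ℕ) (hn : 1 ≤ n)
    (μ : ℝ) (hμ : μ = min α β)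
    (h : ℝ) (hh : h = Real.arsinh (DESinc.q (d * n / μ)) / n)
    (M N : ℤ)
    (hMN :
      (μ = α ∧ M = n ∧ N = ⌈1 / h * Real.arsinh (α / β * DESinc.q (d * n / μ))⌉) ∨
      (μ = β ∧ N = n ∧ M = ⌈1 / h * Real.arsinh (β / α * DESinc.q (d * n / μ))⌉)) :
    max M N = (n : ℤ) ∧
    BddAbove (Set.range fun x : ℝ => ‖F (x : ℂ) - DESinc.sincApprox F h M N x‖) ∧
    (⨆ x : ℝ, ‖F (x : ℂ) - DESinc.sincApprox F h M N x‖) ≤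
      DESinc.errorConst L R α β d *
        Real.exp (-(Real.pi * d * n / Real.arsinh (d * n / μ))) := by
  have hn0 : (0 : ℝ) < n := by exact_mod_cast hn
  have hμ0 : 0 < μ := by rw [hμ]; exact lt_min hα hβ
  have hQ : 0 < DESinc.q (d * n / μ) := DESinc.q_pos (by positivity)
  have hh0 : 0 < h := by rw [hh]; exact div_pos (Real.arsinh_pos_iff.2 hQ) hn0
  have hnh : Real.arsinh (DESinc.q (d * n / μ)) = n * h := by rw [hh]; field_simp
  -- On the side where the minimum is attained the ratio is 1 and n meets its condition with
  -- equality; the ceiling on the other side is at most n because its ratio is at most 1.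
  obtain ⟨m, k, rfl, rfl, hmax, hm, hk⟩ : ∃ m k : ℕ, M = m ∧ N = k ∧ max m k = n ∧
      Real.arsinh (μ / α * DESinc.q (d * n / μ)) ≤ m * h ∧
      Real.arsinh (μ / β * DESinc.q (d * n / μ)) ≤ k * h := by
    rcases hMN with ⟨e, hM, hN⟩ | ⟨e, hN, hM⟩
    · have hαβ : α ≤ β := by rw [← e, hμ]; exact min_le_right α β
      obtain ⟨k, h1, h2, h3⟩ := DESinc.exists_ceil_eq_natCast hh0 hQ (div_pos hα hβ)
        ((div_le_one hβ).2 hαβ) hnh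
      refine ⟨n, k, hM, hN.trans h1, max_eq_left h2, ?_, by rwa [← e] at h3⟩
      rw [e, div_self hα.ne', one_mul, ← e, hnh]
    · have hβα : β ≤ α := by rw [← e, hμ]; exact min_le_left α β
      obtain ⟨m, h1, h2, h3⟩ := DESinc.exists_ceil_eq_natCast hh0 hQ (div_pos hβ hα)
        ((div_le_one hα).2 hβα) hnh
      refine ⟨m, n, hM.trans h1, hN, max_eq_right h2, by rwa [← e] at h3, ?_⟩
      rw [e, div_self hβ.ne', one_mul, ← e, hnh]
  have key := DESinc.norm_sub_sincApprox_le_errorConst hL hR hα hβ hd hd' hF hn hμ hh hm hk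
  refine ⟨by exact_mod_cast hmax, ⟨_, Set.forall_mem_range.2 key⟩, ciSup_le key⟩
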